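/- Let $L$ be a (possibly many-sorted) first-order language and $T$ an NIP $L$-theory, i.e. for every partitioned $L$-formula $\varphi(x;t)$ there is $k\in\mathbb N$ such that in no model of $T$ a set of $k$ $x$-tuples is shattered by the instances of $\varphi$. Let $\tilde L\supseteq L$ be a language (possibly with new sorts), $\tilde T\supseteq T$ a complete $\tilde L$-theory, and $\chi_1(x;s)$, $\chi_2(x;s)$ two $\tilde L$-formulas, where $x$ is a finite tuple of variables of sorts in $L$ and $s$ is a finite tuple of variables of sorts in $\tilde L$. Terminology: let $M$ be an $L$-structure, $\varphi(x;t)$ an $L$-formula and $X,Y$ sets of $x$-tuples of $M$. The sets $X$ and $Y$ are *externally $\varphi$-separable* if there are an elementary extension $N\succeq M$ and a tuple $b$ in $N$ such that $X\subseteq\varphi(M;b)$ and $Y\cap\varphi(M;b)=\emptyset$, where $\varphi(M;b)=\{m\in M : N\models\varphi(m;b)\}$. They are *$\varphi$-separable* if such a tuple $b$ exists in $M$ itself. For $M\models\tilde T$ these notions are applied to the reduct $M|_L$. Then the following three conditions are equivalent. (i) For all $L$-formulas $\varphi(x;t)$, all $M\models\tilde T$ and all tuples $a$ in $M$, there exists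 an $L$-formula $\xi(x;z)$ such that, if $\chi_1(M;a)$ and $\chi_2(M;a)$ are externally $\varphi$-separable, then they are $\xi$-separable. (ii) For all $L$-formulas $\varphi(x;t)$ there exists an $L$-formula $\xi(x;z)$ such that, for all $M\models\tilde T$ and all tuples $a$ in $M$, if $\chi_1(M;a)$ and $\chi_2(M;a)$ are externally $\varphi$-separable, then they are $\xi$-separable. (iii) For all $L$-formulas $\varphi(x;t)$ there exist an $L$-formula $\xi(x;z)$ and a model $M\models\tilde T$ such that, for all tuples $a$ in $M$, if $\chi_1(M;a)$ and $\chi_2(M;a)$ are externally $\varphi$-separable, then they are $\xi$-separable. -/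

import Mathlib

universe u v w

/-- A many-sorted first-order language: sorts, function symbols (constants are the function symbols
of arity `0`) and relation symbols, each with a finite arity and a sort for each argument. -/
structure MSLanguage where
  Srt : Type u
  Func : Type u
  Rel : Type u
  funcArity : Func → ℕ
  funcDom : (f : Func) → Fin (funcArity f) → Srt
  funcCod : Func → Srt
  relArity : Rel → ℕ
  relDom : (R : Rel) → Fin (relArity R) → Srt

namespace MSLanguage

/-- Bound variables: `BVar τ s` is the set of positions of the list `τ` that carry the sort `s`. -/
inductive BVar {S : Type u} : List S → S → Type u
  | zero {s : S} {τ : List S} : BVar (s :: τ) s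
  | succ {s r : S} {τ : List S} (i : BVar τ s) : BVar (r :: τ) s

/-- The assignment of no bound variables. -/
def BVar.nilEnv {S : Type u} {C : S → Type w} : ∀ r, BVar ([] : List S) r → C r :=
  fun _ i => nomatch i

/-- Extend an assignment of the bound variables in `τ` by a value for a new one of sort `s`. -/
def BVar.consEnv {S : Type u} {C : S → Type w} {s : S} {τ : List S} (c : C s)
    (e : ∀ r, BVar τ r → C r) : ∀ r, BVar (s :: τ) r → C r
  | _, .zero => c
  | _, .succ i => e _ i

/-- Terms of `L` of a given sort, with free variables `a : α`, of sort `σ a`, and bound variables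
from the list `τ`. -/
inductive Term (L : MSLanguage.{u}) {α : Type v} (σ : α → L.Srt) (τ : List L.Srt) :
    L.Srt → Type (max u v)
  | fvar (a : α) : Term L σ τ (σ a)
  | bvar {s : L.Srt} (i : BVar τ s) : Term L σ τ s
  | app (f : L.Func) (ts : ∀ i, Term L σ τ (L.funcDom f i)) : Term L σ τ (L.funcCod f)

/-- First-order formulas of `L`, with free variables `a : α` of sort `σ a`, in the scope of
quantified variables of the sorts listed in `τ`. The other connectives and the existential
quantifier are the usual (classical) abbreviations. -/
inductive BFormula (L : MSLanguage.{u}) {α : Type v} (σ : α → L.Srt) :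
    List L.Srt → Type (max u v)
  | falsum {τ : List L.Srt} : BFormula L σ τ
  | equal {τ : List L.Srt} {s : L.Srt} (t₁ t₂ : L.Term σ τ s) : BFormula L σ τ
  | rel {τ : List L.Srt} (R : L.Rel) (ts : ∀ i, L.Term σ τ (L.relDom R i)) : BFormula L σ τ
  | imp {τ : List L.Srt} (φ ψ : BFormula L σ τ) : BFormula L σ τ
  | all {τ : List L.Srt} (s : L.Srt) (φ : BFormula L σ (s :: τ)) : BFormula L σ τ

/-- `L`-formulas whose free variables are among the `a : α`, of sort `σ a`. -/
abbrev Formula (L : MSLanguage.{u}) {α : Type v} (σ : α → L.Srt) : Type (max u v) :=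
  L.BFormula σ []

/-- A partitioned formula `φ(x;t)`, where `x` and `t` are finite tuples of variables, given by
their sorts. -/
abbrev PFormula (L : MSLanguage.{u}) {n m : ℕ} (x : Fin n → L.Srt) (t : Fin m → L.Srt) : Type u :=
  L.Formula (Sum.elim x t)

/-- `L`-sentences. -/
abbrev Sentence (L : MSLanguage.{u}) : Type u :=
  L.Formula (Empty.elim : Empty → L.Srt)

/-- An `L`-theory is a set of `L`-sentences. -/
abbrev Theory (L : MSLanguage.{u}) : Type u := Set L.Sentence

/-- `L`-structures; as usual, every sort is interpreted by a nonempty set. -/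
structure Structure (L : MSLanguage.{u}) where
  carrier : L.Srt → Type w
  nonempty : ∀ s, Nonempty (carrier s)
  funMap : (f : L.Func) → (∀ i, carrier (L.funcDom f i)) → carrier (L.funcCod f)
  relMap : (R : L.Rel) → (∀ i, carrier (L.relDom R i)) → Prop

/-- Tuples of elements of `M` of the sorts `x`. -/
abbrev Structure.Tuple {L : MSLanguage.{u}} (M : Structure.{u, w} L) {α : Type v} (x : α → L.Srt) :
    Type (max v w) :=
  ∀ i, M.carrier (x i)

/-- The concatenation `(a, b)` of two tuples. -/
def Structure.pair {L : MSLanguage.{u}} (M : Structure.{u, w} L) {α β : Type v} {x : α → L.Srt}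
    {t : β → L.Srt} (a : M.Tuple x) (b : M.Tuple t) : M.Tuple (Sum.elim x t)
  | .inl i => a i
  | .inr j => b j

/-- The empty tuple, at which sentences are evaluated. -/
def Structure.emptyTuple {L : MSLanguage.{u}} (M : Structure.{u, w} L) :
    M.Tuple (Empty.elim : Empty → L.Srt) :=
  fun i => i.elim

/-- The value of a term. -/
def Term.eval {L : MSLanguage.{u}} (M : Structure.{u, w} L) {α : Type v} {σ : α → L.Srt}
    {τ : List L.Srt} (a : M.Tuple σ) (e : ∀ r, BVar τ r → M.carrier r) :
    ∀ {s : L.Srt}, L.Term σ τ s → M.carrier s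
  | _, .fvar i => a i
  | _, .bvar i => e _ i
  | _, .app f ts => M.funMap f fun i => (ts i).eval M a e

/-- Tarski's truth definition. -/
def BFormula.Holds {L : MSLanguage.{u}} (M : Structure.{u, w} L) {α : Type v} {σ : α → L.Srt}
    (a : M.Tuple σ) :
    ∀ {τ : List L.Srt}, L.BFormula σ τ → (∀ r, BVar τ r → M.carrier r) → Prop
  | _, .falsum, _ => False
  | _, .equal t₁ t₂, e => t₁.eval M a e = t₂.eval M a e
  | _, .rel R ts, e => M.relMap R fun i => (ts i).eval M a e
  | _, .imp φ ψ, e => φ.Holds M a e → ψ.Holds M a e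
  | _, .all s φ, e => ∀ c : M.carrier s, φ.Holds M a (BVar.consEnv c e)

/-- `M ⊨ φ(a)`. -/
def Formula.Realize {L : MSLanguage.{u}} (M : Structure.{u, w} L) {α : Type v} {σ : α → L.Srt}
    (φ : L.Formula σ) (a : M.Tuple σ) : Prop :=
  BFormula.Holds M a φ BVar.nilEnv

/-- `φ(M;b)`: the set of tuples `a` of `M` with `M ⊨ φ(a;b)`. -/
def PFormula.solSet {L : MSLanguage.{u}} (M : Structure.{u, w} L) {n m : ℕ} {x : Fin n → L.Srt}
    {t : Fin m → L.Srt} (φ : L.PFormula x t) (b : M.Tuple t) : Set (M.Tuple x) :=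
  {a | Formula.Realize M φ (M.pair a b)}

/-- `M ⊨ T`. -/
def Structure.Models {L : MSLanguage.{u}} (M : Structure.{u, w} L) (T : L.Theory) : Prop :=
  ∀ ψ ∈ T, Formula.Realize M ψ M.emptyTuple

/-- A theory is complete if it is consistent (has a model) and decides every sentence. The universe
`w` in which models are taken is at least that of the language where this is used. -/
def Theory.IsComplete {L : MSLanguage.{u}} (T : L.Theory) : Prop :=
  (∃ M : Structure.{u, w} L, M.Models T) ∧
    ∀ ψ : L.Sentence,
      (∀ M : Structure.{u, w} L, M.Models T → Formula.Realize M ψ M.emptyTuple) ∨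
      (∀ M : Structure.{u, w} L, M.Models T → ¬ Formula.Realize M ψ M.emptyTuple)

/-- `φ(x;t)` is NIP in `T`: there is a `k` such that in no model of `T` a set of `k` tuples is
shattered by instances of `φ`. -/
def PFormula.IsNIP {L : MSLanguage.{u}} (T : L.Theory) {n m : ℕ} {x : Fin n → L.Srt}
    {t : Fin m → L.Srt} (φ : L.PFormula x t) : Prop :=
  ∃ k : ℕ, ∀ M : Structure.{u, w} L, M.Models T →
    ¬ ∃ (a : Fin k → M.Tuple x) (b : Set (Fin k) → M.Tuple t),
      ∀ i J, a i ∈ PFormula.solSet M φ (b J) ↔ i ∈ J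

/-- A theory is NIP if all partitioned formulas are NIP in it. -/
def Theory.IsNIP {L : MSLanguage.{u}} (T : L.Theory) : Prop :=
  ∀ {n m : ℕ} (x : Fin n → L.Srt) (t : Fin m → L.Srt) (φ : L.PFormula x t),
    PFormula.IsNIP.{u, w} T φ

/-- Elementary embeddings of `M` into `N`, which present `N` as an elementary extension of `M`. -/
structure ElementaryEmbedding {L : MSLanguage.{u}} (M N : Structure.{u, w} L) where
  toFun : ∀ s, M.carrier s → N.carrier s
  map_formula : ∀ {n : ℕ} (x : Fin n → L.Srt) (φ : L.Formula x) (a : M.Tuple x),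
    Formula.Realize N φ (fun i => toFun _ (a i)) ↔ Formula.Realize M φ a

/-- `X` and `Y` are `φ`-separable in `M`: there is a tuple `b` in `M` such that `φ(M;b)` contains
`X` and is disjoint from `Y`. -/
def Separable {L : MSLanguage.{u}} (M : Structure.{u, w} L) {n m : ℕ} {x : Fin n → L.Srt}
    {t : Fin m → L.Srt} (φ : L.PFormula x t) (X Y : Set (M.Tuple x)) : Prop :=
  ∃ b : M.Tuple t, X ⊆ PFormula.solSet M φ b ∧ Y ∩ PFormula.solSet M φ b = ∅

/-- `X` and `Y` are externally `φ`-separable: there are an elementary extension `N` of `M` and a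
tuple `b` in `N` such that `φ(M;b) = {a ∈ M | N ⊨ φ(a;b)}` contains `X` and is disjoint from `Y`. -/
def ExternallySeparable {L : MSLanguage.{u}} (M : Structure.{u, w} L) {n m : ℕ}
    {x : Fin n → L.Srt} {t : Fin m → L.Srt} (φ : L.PFormula x t) (X Y : Set (M.Tuple x)) : Prop :=
  ∃ (N : Structure.{u, w} L) (j : ElementaryEmbedding M N) (b : N.Tuple t),
    X ⊆ {a | (fun i => j.toFun _ (a i)) ∈ PFormula.solSet N φ b} ∧
    Y ∩ {a | (fun i => j.toFun _ (a i)) ∈ PFormula.solSet N φ b} = ∅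

/-- What has to be added to a language `L` to get a language containing it: the sorts, function
symbols and relation symbols that are not in `L`. New symbols may involve old and new sorts. -/
structure Enrichment (L : MSLanguage.{u}) where
  NewSrt : Type u
  NewFunc : Type u
  NewRel : Type u
  newFuncArity : NewFunc → ℕ
  newFuncDom : (f : NewFunc) → Fin (newFuncArity f) → L.Srt ⊕ NewSrt
  newFuncCod : NewFunc → L.Srt ⊕ NewSrt
  newRelArity : NewRel → ℕ
  newRelDom : (R : NewRel) → Fin (newRelArity R) → L.Srt ⊕ NewSrt

namespace Enrichment

/-- The enriched language, which contains `L` as its left summand. -/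
@[reducible] def lang {L : MSLanguage.{u}} (E : L.Enrichment) : MSLanguage.{u} where
  Srt := L.Srt ⊕ E.NewSrt
  Func := L.Func ⊕ E.NewFunc
  Rel := L.Rel ⊕ E.NewRel
  funcArity := fun f => match f with
    | .inl f => L.funcArity f
    | .inr f => E.newFuncArity f
  funcDom := fun f => match f with
    | .inl f => fun i => .inl (L.funcDom f i)
    | .inr f => E.newFuncDom f
  funcCod := fun f => match f with
    | .inl f => .inl (L.funcCod f)
    | .inr f => E.newFuncCod f
  relArity := fun R => match R with
    | .inl R => L.relArity R
    | .inr R => E.newRelArity R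
  relDom := fun R => match R with
    | .inl R => fun i => .inl (L.relDom R i)
    | .inr R => E.newRelDom R

/-- The reduct to `L` of a structure for the enriched language. -/
@[reducible] def reduct {L : MSLanguage.{u}} (E : L.Enrichment) (M : Structure.{u, w} E.lang) :
    Structure.{u, w} L where
  carrier := fun s => M.carrier (.inl s)
  nonempty := fun s => M.nonempty (.inl s)
  funMap := fun f a => M.funMap (.inl f) a
  relMap := fun R a => M.relMap (.inl R) a

/-- A bound variable of `L`, read in the enriched language. -/
def liftBVar {L : MSLanguage.{u}} (E : L.Enrichment) :
    ∀ {τ : List L.Srt} {s : L.Srt}, BVar τ s →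
      BVar (S := E.lang.Srt) (τ.map Sum.inl) (.inl s)
  | _, _, .zero => .zero
  | _, _, .succ i => .succ (E.liftBVar i)

/-- An `L`-term, read in the enriched language. -/
def liftTerm {L : MSLanguage.{u}} (E : L.Enrichment) {α : Type v} {σ : α → L.Srt}
    {τ : List L.Srt} : ∀ {s : L.Srt}, L.Term σ τ s →
      E.lang.Term (fun i => Sum.inl (σ i)) (τ.map Sum.inl) (.inl s)
  | _, .fvar i => .fvar i
  | _, .bvar i => .bvar (E.liftBVar i)
  | _, .app f ts => .app (L := E.lang) (Sum.inl f : L.Func ⊕ E.NewFunc) fun i => E.liftTerm (ts i)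

/-- An `L`-formula, read in the enriched language. -/
def liftFormula {L : MSLanguage.{u}} (E : L.Enrichment) {α : Type v} {σ : α → L.Srt} :
    ∀ {τ : List L.Srt}, L.BFormula σ τ →
      E.lang.BFormula (fun i => Sum.inl (σ i)) (τ.map Sum.inl)
  | _, .falsum => .falsum
  | _, .equal t₁ t₂ => .equal (E.liftTerm t₁) (E.liftTerm t₂)
  | _, .rel R ts => .rel (.inl R) fun i => E.liftTerm (ts i)
  | _, .imp φ ψ => .imp (E.liftFormula φ) (E.liftFormula ψ)
  | _, .all s φ => .all (.inl s) (E.liftFormula φ)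

/-- An `L`-sentence, read in the enriched language. -/
def liftSentence {L : MSLanguage.{u}} (E : L.Enrichment) (ψ : L.Sentence) : E.lang.Sentence :=
  have h : (fun i => Sum.inl (Empty.elim i) : Empty → E.lang.Srt) = Empty.elim :=
    Subsingleton.elim _ _
  cast (congrArg (fun σ : Empty → E.lang.Srt => E.lang.Formula σ) h) (E.liftFormula ψ)

/-- The set `χ(M;a)` defined by a formula of the enriched language, in which the variables `x` have
sorts in `L`, as a set of tuples of the reduct of `M`. -/
def solSet {L : MSLanguage.{u}} (E : L.Enrichment) (M : Structure.{u, w} E.lang) {n l : ℕ}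
    {x : Fin n → L.Srt} {s : Fin l → E.lang.Srt}
    (χ : E.lang.PFormula (fun i => Sum.inl (x i)) s) (a : M.Tuple s) :
    Set ((E.reduct M).Tuple x) :=
  PFormula.solSet M χ a

end Enrichment

end MSLanguage

namespace VC

/-! ### Traces of families of sets -/

open Finset

variable {Ω Ω' I : Type*}

open Classical in
/-- The family of sets `F i` has at most `(n + 1) ^ D` traces on each set of `n` points. -/
def TraceBound (D : ℕ) (F : I → Ω → Prop) : Prop :=
  ∀ T : Finset Ω, (Set.range fun i => {ω ∈ T | F i ω}).ncard ≤ (#T + 1) ^ D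

/-- No set of `k` points is shattered by the family of sets `{p | r p b}`. -/
def NoShatter {P B : Type*} (k : ℕ) (r : P → B → Prop) : Prop :=
  ¬ ∃ (a : Fin k → P) (b : Set (Fin k) → B), ∀ i J, r (a i) (b J) ↔ i ∈ J

open Classical in
theorem finite_range_filter (F : I → Ω → Prop) (T : Finset Ω) :
    (Set.range fun i => {ω ∈ T | F i ω}).Finite :=
  T.powerset.finite_toSet.subset (by
    rintro _ ⟨i, rfl⟩; exact mem_coe.2 (mem_powerset.2 (filter_subset _ _)))

theorem ncard_range_le {A B : Type*} (f : I → A) (h : I → B) (hf : (Set.range f).Finite)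
    (hfh : ∀ i i', f i = f i' → h i = h i') : (Set.range h).ncard ≤ (Set.range f).ncard := by
  rcases isEmpty_or_nonempty I with hI | ⟨⟨i₀⟩⟩
  · simp [Set.range_eq_empty h]
  have : Nonempty B := ⟨h i₀⟩
  have hh : h = Function.extend f h (fun _ => h i₀) ∘ f := by
    funext i
    exact (Function.FactorsThrough.extend_apply (fun i i' => hfh i i') _ i).symm
  rw [hh, Set.range_comp]
  exact Set.ncard_image_le hf

/-- The trace of `F i` on `T` is determined by the trace of `G i` on `g(T)`, which has at most as
many points as `T`. -/
theorem TraceBound.of_iff {D : ℕ} {F : I → Ω → Prop} {G : I → Ω' → Prop} (h : TraceBound D G)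
    (g : Ω → Ω')
    (hg : ∀ i i' ω, (G i (g ω) ↔ G i' (g ω)) → (F i ω ↔ F i' ω)) : TraceBound D F := by
  classical
  intro T
  refine (ncard_range_le (fun i => {ω ∈ T.image g | G i ω}) _ (finite_range_filter _ _)
    fun i i' hii' => ?_).trans ((h (T.image g)).trans
      (Nat.pow_le_pow_left (Nat.succ_le_succ card_image_le) D))
  refine filter_congr fun ω hω => hg i i' ω ?_
  have := congrArg (g ω ∈ ·) hii'
  simpa [mem_filter, mem_image_of_mem g hω] using this

/-- The trace of a symmetric difference is determined by the two traces, so the numbers of traces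
multiply and the exponent doubles. -/
theorem TraceBound.not_iff {D : ℕ} {G : I → Ω → Prop} (h : TraceBound D G) :
    TraceBound (2 * D) fun (i : I × I) ω => ¬ (G i.1 ω ↔ G i.2 ω) := by
  classical
  intro T
  have hfin := finite_range_filter G T
  have hrange : Set.range (fun i : I × I => (({ω ∈ T | G i.1 ω} : Finset Ω),
      ({ω ∈ T | G i.2 ω} : Finset Ω))) =
      (Set.range fun i => {ω ∈ T | G i ω}) ×ˢ (Set.range fun i => {ω ∈ T | G i ω}) :=
    Set.range_prodMap (m₁ := fun i => ({ω ∈ T | G i ω} : Finset Ω))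
      (m₂ := fun i => ({ω ∈ T | G i ω} : Finset Ω))
  refine (ncard_range_le (fun i : I × I => (({ω ∈ T | G i.1 ω} : Finset Ω),
    ({ω ∈ T | G i.2 ω} : Finset Ω))) _ (hrange ▸ hfin.prod hfin) fun i i' hii' => ?_).trans ?_
  · refine Finset.ext fun ω => ?_
    simp only [mem_filter]
    refine and_congr_right fun hω => ?_
    have h₁ := congrArg (ω ∈ ·.1) hii'
    have h₂ := congrArg (ω ∈ ·.2) hii'
    simp only [mem_filter, hω, true_and, eq_iff_iff] at h₁ h₂
    rw [h₁, h₂]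
  · rw [hrange, Set.ncard_prod, two_mul, pow_add]
    exact Nat.mul_le_mul (h T) (h T)

/-- The **Sauer-Shelah lemma**. -/
theorem NoShatter.traceBound {P B : Type*} {k : ℕ} {r : P → B → Prop} (h : NoShatter k r) :
    TraceBound k fun b p => r p b := by
  classical
  intro T
  have hfin := finite_range_filter (fun b p => r p b) T
  rw [Set.ncard_eq_toFinset_card _ hfin]
  refine (card_le_card_shatterer _).trans ?_
  -- A family has at most as many members as it shatters sets; here the shattered sets are subsets
  -- of `T` with fewer than `k` elements.
  have hsub : hfin.toFinset.shatterer ⊆ (range k).biUnion fun i => T.powersetCard i := by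
    intro s hs
    rw [mem_shatterer] at hs
    have hsT : s ⊆ T := by
      obtain ⟨t, ht, hst⟩ := hs.exists_superset
      obtain ⟨b, rfl⟩ := hfin.mem_toFinset.1 ht
      exact hst.trans (filter_subset _ _)
    rw [mem_biUnion]
    refine ⟨#s, mem_range.2 ?_, mem_powersetCard.2 ⟨hsT, rfl⟩⟩
    by_contra! hk
    have a : Fin k ↪ s := (Fin.castLEEmb hk).trans s.equivFin.symm.toEmbedding
    have hJ : ∀ J : Set (Fin k), ∃ b, ∀ i, r (a i) b ↔ i ∈ J := by
      intro J
      obtain ⟨t, ht, hst⟩ := hs (t := s.filter fun p => ∃ i ∈ J, (a i : P) = p)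
        (filter_subset _ _)
      obtain ⟨b, rfl⟩ := hfin.mem_toFinset.1 ht
      refine ⟨b, fun i => ?_⟩
      have := congrArg ((a i : P) ∈ ·) hst
      simp only [mem_inter, mem_filter, (a i).2, hsT (a i).2, true_and, eq_iff_iff] at this
      rw [this]
      refine ⟨?_, fun hi => ⟨i, hi, rfl⟩⟩
      rintro ⟨i', hi', he⟩
      rwa [← a.injective (Subtype.ext he)]
    choose b hb using hJ
    exact h ⟨fun i => a i, b, fun i J => hb J i⟩
  refine (card_le_card hsub).trans (card_biUnion_le.trans ?_)
  -- Termwise comparison with the binomial expansion of `(#T + 1) ^ k`: the number of `i`-subsets of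
  -- `T` is at most `#T ^ i`, and `k.choose i ≥ 1`.
  rw [add_pow]
  refine (sum_le_sum_of_subset (range_subset_range.2 k.le_succ)).trans (sum_le_sum fun i hi => ?_)
  rw [card_powersetCard, one_pow, mul_one]
  exact (Nat.choose_le_pow _ _).trans
    (Nat.le_mul_of_pos_right _ (Nat.choose_pos (Nat.lt_succ_iff.1 (mem_range.1 hi))))

/-! ### Nets -/

section Net

variable {j r : ℕ}

/-- Exchange the entries of two samples at the places where `σ` is true. -/
def swap {J : Type*} (σ : J → Bool) (S : (J → Ω) × (J → Ω)) : (J → Ω) × (J → Ω) :=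
  (fun c => if σ c then S.2 c else S.1 c, fun c => if σ c then S.1 c else S.2 c)

theorem swap_swap {J : Type*} (σ : J → Bool) (S : (J → Ω) × (J → Ω)) : swap σ (swap σ S) = S := by
  ext c <;> simp only [swap] <;> split <;> rfl

/-- The set `A` contains no point of the first sample and a point of each block of the second. -/
def Splits (A : Ω → Prop) (S : (Fin j × Fin r → Ω) × (Fin j × Fin r → Ω)) : Prop :=
  (∀ c, ¬ A (S.1 c)) ∧ ∀ a, ∃ b, A (S.2 (a, b))

open Classical in
-- Fix one good swap `σ₀` and, in each block, a place where its second sample meets `A`. There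
-- exactly one of the two original entries lies in `A`, so every good swap agrees with `σ₀` at these
-- `j` places. Overwriting these places by arbitrary bits is therefore injective on pairs of a good
-- swap and `j` bits.
theorem card_splits_swap_le (A : Ω → Prop) (S : (Fin j × Fin r → Ω) × (Fin j × Fin r → Ω)) :
    #{σ : Fin j × Fin r → Bool | Splits A (swap σ S)} * 2 ^ j ≤ 2 ^ (j * r) := by
  rcases Finset.eq_empty_or_nonempty {σ : Fin j × Fin r → Bool | Splits A (swap σ S)} with h | h
  · rw [h]; simp
  obtain ⟨σ₀, h₀⟩ := h
  obtain ⟨h₁, h₂⟩ := (mem_filter.1 h₀).2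
  choose b hb using h₂
  have key : ∀ σ, Splits A (swap σ S) → ∀ a, σ (a, b a) = σ₀ (a, b a) := by
    intro σ hσ a
    have h₃ := h₁ (a, b a)
    have h₄ := hb a
    have h₅ := hσ.1 (a, b a)
    simp only [swap] at h₃ h₄ h₅
    cases h : σ (a, b a) <;> cases h' : σ₀ (a, b a) <;> simp_all
  have hcard : #(({σ : Fin j × Fin r → Bool | Splits A (swap σ S)} : Finset _) ×ˢ
      (univ : Finset (Fin j → Bool))) ≤ #(univ : Finset (Fin j × Fin r → Bool)) := by
    refine card_le_card_of_injOn
      (fun x c => if c.2 = b c.1 then x.2 c.1 else x.1 c) (fun _ _ => mem_coe.2 (mem_univ _)) ?_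
    rintro ⟨σ, τ⟩ hσ ⟨σ', τ'⟩ hσ' h
    have hσ := (mem_filter.1 (mem_product.1 (mem_coe.1 hσ)).1).2
    have hσ' := (mem_filter.1 (mem_product.1 (mem_coe.1 hσ')).1).2
    refine Prod.ext (funext fun c => ?_) (funext fun a => ?_)
    · by_cases hc : c.2 = b c.1
      · have : c = (c.1, b c.1) := Prod.ext rfl hc
        rw [this]
        exact (key σ hσ _).trans (key σ' hσ' _).symm
      · simpa [hc] using congrFun h c
    · simpa using congrFun h (a, b a)
  simpa [card_product] using hcard

open Classical in
-- Union bound over traces: whether `F i` splits a swapped pair depends only on its trace on the at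
-- most `2 * (j * r)` points of the two samples.
theorem card_exists_splits_swap_le {D : ℕ} {F : I → Ω → Prop} (hF : TraceBound D F)
    (S : (Fin j × Fin r → Ω) × (Fin j × Fin r → Ω)) :
    #{σ : Fin j × Fin r → Bool | ∃ i, Splits (F i) (swap σ S)} * 2 ^ j ≤
      (2 * (j * r) + 1) ^ D * 2 ^ (j * r) := by
  let T : Finset Ω := univ.image S.1 ∪ univ.image S.2
  have hT : #T ≤ 2 * (j * r) := by
    refine (card_union_le _ _).trans ?_
    have h₁ : #(univ.image S.1) ≤ j * r := card_image_le.trans (by simp)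
    have h₂ : #(univ.image S.2) ≤ j * r := card_image_le.trans (by simp)
    omega
  have hfin := finite_range_filter F T
  have hsub : ({σ : Fin j × Fin r → Bool | ∃ i, Splits (F i) (swap σ S)} : Finset _) ⊆
      hfin.toFinset.biUnion fun A => {σ : Fin j × Fin r → Bool | Splits (· ∈ A) (swap σ S)} := by
    intro σ hσ
    obtain ⟨i, hi⟩ := (mem_filter.1 hσ).2
    refine mem_biUnion.2 ⟨_, hfin.mem_toFinset.2 ⟨i, rfl⟩, mem_filter.2 ⟨mem_univ _, ?_⟩⟩
    have hmem : ∀ c, (swap σ S).2 c ∈ T := by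
      intro c
      simp only [swap, T]
      split <;> simp
    exact ⟨fun c hc => hi.1 c (mem_filter.1 hc).2, fun a => (hi.2 a).imp fun b hb =>
      mem_filter.2 ⟨hmem _, hb⟩⟩
  refine (Nat.mul_le_mul_right _ ((card_le_card hsub).trans card_biUnion_le)).trans ?_
  rw [sum_mul]
  refine (sum_le_sum fun A _ => card_splits_swap_le (· ∈ A) S).trans ?_
  rw [sum_const, smul_eq_mul, ← Set.ncard_eq_toFinset_card _ hfin]
  exact Nat.mul_le_mul_right _ ((hF T).trans (Nat.pow_le_pow_left (Nat.succ_le_succ hT) D))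

variable [Fintype Ω]

theorem sum_prod_sample {J : Type*} [Fintype J] [DecidableEq J] (w : Ω → ℝ) (hw : ∑ ω, w ω = 1) :
    ∑ S : J → Ω, ∏ c, w (S c) = 1 := by
  rw [← Fintype.prod_sum fun (_ : J) ω => w ω]
  simp [hw]

open Classical in
-- The sum factors over the coordinates: each of the `r` coordinates of block `a` contributes the
-- weight of the complement of `A`, all others contribute `1`.
theorem sum_prod_of_miss {w : Ω → ℝ} (hw : ∑ ω, w ω = 1) (A : Ω → Prop) (a : Fin j) :
    ∑ S : Fin j × Fin r → Ω, (if ∀ b, ¬ A (S (a, b)) then ∏ c, w (S c) else 0) =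
      (1 - ∑ ω with A ω, w ω) ^ r := by
  have h₁ : ∀ S : Fin j × Fin r → Ω,
      (if ∀ b, ¬ A (S (a, b)) then ∏ c, w (S c) else 0) =
        ∏ c : Fin j × Fin r, if c.1 = a ∧ A (S c) then 0 else w (S c) := by
    intro S
    split_ifs with h
    · refine prod_congr rfl fun c _ => (if_neg ?_).symm
      rintro ⟨rfl, hc⟩
      exact h c.2 hc
    · push Not at h
      obtain ⟨b, hb⟩ := h
      symm
      refine Finset.prod_eq_zero (mem_univ (a, b)) ?_
      simp [hb]
  rw [sum_congr rfl fun S _ => h₁ S,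
    ← Fintype.prod_sum fun (c : Fin j × Fin r) ω => if c.1 = a ∧ A ω then 0 else w ω]
  have h₂ : ∀ c : Fin j × Fin r, (∑ ω, if c.1 = a ∧ A ω then 0 else w ω) =
      if c.1 = a then 1 - ∑ ω with A ω, w ω else 1 := by
    intro c
    split_ifs with hc
    · simp only [hc, true_and]
      rw [eq_sub_iff_add_eq, sum_filter, ← sum_add_distrib, ← hw]
      exact sum_congr rfl fun ω _ => by split_ifs <;> simp
    · simpa [hc] using hw
  rw [prod_congr rfl fun c _ => h₂ c, Fintype.prod_prod_type]
  rw [Finset.prod_eq_single a (fun b _ hb => by simp [hb]) (by simp)]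
  simp

open Classical in
-- Union bound over the blocks: a given block misses `A` with probability at most `(1 - ε) ^ r`.
theorem half_le_sum_of_hit {w : Ω → ℝ} (hw₀ : ∀ ω, 0 ≤ w ω) (hw : ∑ ω, w ω = 1) {A : Ω → Prop}
    {ε : ℝ} (hA : ε ≤ ∑ ω with A ω, w ω) (hjr : j * (1 - ε) ^ r ≤ 1 / 2) :
    1 / 2 ≤ ∑ S : Fin j × Fin r → Ω, if ∀ a, ∃ b, A (S (a, b)) then ∏ c, w (S c) else 0 := by
  have hA₁ : ∑ ω with A ω, w ω ≤ 1 :=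
    hw ▸ sum_le_sum_of_subset_of_nonneg (filter_subset _ _) fun ω _ _ => hw₀ ω
  have hW : ∀ S : Fin j × Fin r → Ω, 0 ≤ ∏ c, w (S c) := fun S => prod_nonneg fun c _ => hw₀ _
  have h₁ : ∀ S : Fin j × Fin r → Ω, ∏ c, w (S c) ≤
      (if ∀ a, ∃ b, A (S (a, b)) then ∏ c, w (S c) else 0) +
        ∑ a, if ∀ b, ¬ A (S (a, b)) then ∏ c, w (S c) else 0 := by
    intro S
    have hnn : ∀ a, 0 ≤ if ∀ b, ¬ A (S (a, b)) then ∏ c, w (S c) else 0 := fun a => by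
      split_ifs
      exacts [hW S, le_rfl]
    split_ifs with h
    · exact le_add_of_nonneg_right (sum_nonneg fun a _ => hnn a)
    · push Not at h
      obtain ⟨a, ha⟩ := h
      rw [zero_add]
      refine le_trans ?_ (single_le_sum (fun a _ => hnn a) (mem_univ a))
      rw [if_pos ha]
  have h₂ := sum_le_sum fun S (_ : S ∈ univ) => h₁ S
  rw [sum_prod_sample w hw, sum_add_distrib, sum_comm] at h₂
  simp only [sum_prod_of_miss hw, sum_const, card_univ, Fintype.card_fin, nsmul_eq_mul] at h₂
  have h₃ : (1 - ∑ ω with A ω, w ω) ^ r ≤ (1 - ε) ^ r :=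
    pow_le_pow_left₀ (by linarith) (by linarith) r
  have h₄ := mul_le_mul_of_nonneg_left h₃ (Nat.cast_nonneg (α := ℝ) j)
  linarith

/-- Double sampling. If no sample is a net, each first sample `S` is missed by a set `F (f S)` of
weight at least `ε`, and an independent second sample meets that set in every block with probability
at least `1/2`. But randomly exchanging entries of the two samples preserves their distribution, and
for any fixed pair of samples the proportion of swaps that some `F i` splits is at most `(2 * (j *
r) + 1) ^ D / 2 ^ j < 1/2`. -/
theorem exists_blockNet {D : ℕ} {ε : ℝ} (hjr : j * (1 - ε) ^ r ≤ 1 / 2)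
    (hD : 2 * (2 * (j * r) + 1) ^ D < 2 ^ j) {F : I → Ω → Prop} (hF : TraceBound D F) {w : Ω → ℝ}
    (hw₀ : ∀ ω, 0 ≤ w ω) (hw : ∑ ω, w ω = 1) :
    ∃ S : Fin j × Fin r → Ω, ∀ i, (∀ c, ¬ F i (S c)) →
      (∑ ω, open Classical in if F i ω then w ω else 0) < ε := by
  classical
  by_contra! hS
  choose f hf₁ hf₂ using hS
  let W : (Fin j × Fin r → Ω) × (Fin j × Fin r → Ω) → ℝ := fun S =>
    (∏ c, w (S.1 c)) * ∏ c, w (S.2 c)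
  have hW : ∀ S, 0 ≤ W S := fun S =>
    mul_nonneg (prod_nonneg fun c _ => hw₀ _) (prod_nonneg fun c _ => hw₀ _)
  have hW₁ : ∑ S, W S = 1 := by
    simp only [W, Fintype.sum_prod_type, ← mul_sum, sum_prod_sample w hw, mul_one]
  have h₁ : 1 / 2 ≤ ∑ S, if ∃ i, Splits (F i) S then W S else 0 := by
    rw [Fintype.sum_prod_type]
    have : ∀ S : Fin j × Fin r → Ω, (∏ c, w (S c)) * (1 / 2) ≤
        ∑ S', if ∃ i, Splits (F i) (S, S') then W (S, S') else 0 := by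
      intro S
      refine (mul_le_mul_of_nonneg_left (half_le_sum_of_hit hw₀ hw (A := F (f S)) (by
        rw [sum_filter]; exact hf₂ S) hjr) (prod_nonneg fun c _ => hw₀ _)).trans ?_
      rw [mul_sum]
      refine sum_le_sum fun S' _ => ?_
      by_cases h : ∀ a, ∃ b, F (f S) (S' (a, b))
      · rw [if_pos h, if_pos ⟨f S, hf₁ S, h⟩]
      · rw [if_neg h, mul_zero]
        split_ifs
        exacts [hW _, le_rfl]
    have h := sum_le_sum fun S (_ : S ∈ univ) => this S
    rwa [← sum_mul, sum_prod_sample w hw, one_mul] at h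
  have h₂ : ∀ σ : Fin j × Fin r → Bool, (∑ S, if ∃ i, Splits (F i) S then W S else 0) =
      ∑ S, if ∃ i, Splits (F i) (swap σ S) then W S else 0 := by
    intro σ
    refine (Fintype.sum_equiv (Function.Involutive.toPerm (swap σ) (swap_swap σ)) _ _
      fun S => ?_).symm
    have hWS : W (swap σ S) = W S := by
      simp only [W, ← prod_mul_distrib, swap]
      refine prod_congr rfl fun c _ => ?_
      split_ifs
      exacts [mul_comm _ _, rfl]
    change _ = if ∃ i, Splits (F i) (swap σ S) then W (swap σ S) else 0
    rw [hWS]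
  -- The `- 1` records that a strict inequality between integers leaves a gap of `1`, so strictness
  -- survives averaging over `S`.
  have h₃ : ∑ σ : Fin j × Fin r → Bool, (∑ S, if ∃ i, Splits (F i) S then W S else 0) ≤
      ((2 : ℝ) ^ (j * r) - 1) / 2 := by
    rw [sum_congr rfl fun σ _ => h₂ σ, sum_comm]
    have : ∀ S, (∑ σ : Fin j × Fin r → Bool,
        if ∃ i, Splits (F i) (swap σ S) then W S else 0) ≤ W S * (((2 : ℝ) ^ (j * r) - 1) / 2) := by
      intro S
      rw [← sum_filter, sum_const, nsmul_eq_mul, mul_comm]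
      refine mul_le_mul_of_nonneg_left ?_ (hW S)
      have hc := card_exists_splits_swap_le hF S
      have hlt : 2 * #{σ : Fin j × Fin r → Bool | ∃ i, Splits (F i) (swap σ S)} < 2 ^ (j * r) := by
        refine lt_of_mul_lt_mul_right (a := 2 ^ j) ?_ (Nat.zero_le _)
        calc _ = 2 * (#{σ : Fin j × Fin r → Bool | ∃ i, Splits (F i) (swap σ S)} * 2 ^ j) := by
                ring
          _ ≤ 2 * ((2 * (j * r) + 1) ^ D * 2 ^ (j * r)) := Nat.mul_le_mul_left _ hc
          _ = (2 * (2 * (j * r) + 1) ^ D) * 2 ^ (j * r) := by ring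
          _ < 2 ^ j * 2 ^ (j * r) := Nat.mul_lt_mul_of_pos_right hD (by positivity)
          _ = _ := mul_comm _ _
      have : (2 * #{σ : Fin j × Fin r → Bool | ∃ i, Splits (F i) (swap σ S)} + 1 : ℝ) ≤
          2 ^ (j * r) := by exact_mod_cast hlt
      linarith
    refine (sum_le_sum fun S _ => this S).trans ?_
    rw [← sum_mul, hW₁, one_mul]
  rw [sum_const, card_univ, Fintype.card_fun, Fintype.card_prod, Fintype.card_fin, Fintype.card_fin,
    Fintype.card_bool, nsmul_eq_mul] at h₃
  have h₄ := mul_le_mul_of_nonneg_left h₁ (by positivity : (0 : ℝ) ≤ ((2 ^ (j * r) : ℕ) : ℝ))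
  push_cast at h₃ h₄
  linarith

end Net

/-- Take `r = C * j` with `C ≥ 2 / ε`. Bernoulli's inequality gives `(1 + ε) ^ r ≥ 2 * j`, and `(1 -
ε) * (1 + ε) ≤ 1` turns this into the first bound. The second compares a polynomial of degree `2 *
D` in `j` with `2 ^ j`. -/
theorem exists_block_sizes (D : ℕ) {ε : ℝ} (hε : 0 < ε) (hε₁ : ε ≤ 1) :
    ∃ j r : ℕ, j * (1 - ε) ^ r ≤ 1 / 2 ∧ 2 * (2 * (j * r) + 1) ^ D < 2 ^ j := by
  obtain ⟨C, hC⟩ := exists_nat_ge (2 / ε)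
  have hlim := tendsto_pow_const_div_const_pow_of_one_lt (2 * D) (one_lt_two (α := ℝ))
  have hpos : (0 : ℝ) < 1 / (2 * (2 * C + 1) ^ D) := by positivity
  obtain ⟨j, hj, hj₁⟩ := ((hlim.eventually_lt_const hpos).and
    (Filter.eventually_ge_atTop 1)).exists
  have hj₁' : (1 : ℝ) ≤ j := by exact_mod_cast hj₁
  refine ⟨j, C * j, ?_, ?_⟩
  · have h₁ : (1 - ε) ^ (C * j) * (1 + ε) ^ (C * j) ≤ 1 := by
      rw [← mul_pow]
      exact pow_le_one₀ (by nlinarith) (by nlinarith)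
    have h₂ : 1 + (C * j : ℕ) * ε ≤ (1 + ε) ^ (C * j) := one_add_mul_le_pow (by linarith) _
    have h₃ : 2 * (j : ℝ) ≤ (1 + ε) ^ (C * j) := by
      rw [div_le_iff₀ hε] at hC
      push_cast at h₂
      nlinarith
    have h₄ : 0 ≤ (1 - ε) ^ (C * j) := pow_nonneg (by linarith) _
    nlinarith
  · rw [div_lt_div_iff₀ (by positivity) (by positivity), one_mul] at hj
    have : (2 * (2 * (j * (C * j)) + 1) ^ D : ℝ) < 2 ^ j := by
      refine lt_of_le_of_lt ?_ hj
      have h₁ : (2 * (j * (C * j)) + 1 : ℝ) ≤ j ^ 2 * (2 * C + 1) := by nlinarith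
      calc (2 * (2 * (j * (C * j)) + 1) ^ D : ℝ) ≤ 2 * (j ^ 2 * (2 * C + 1)) ^ D := by gcongr
        _ = _ := by rw [mul_pow, pow_mul]; ring
    exact_mod_cast this

/-- The **`ε`-net theorem**. -/
theorem exists_net (D : ℕ) {ε : ℝ} (hε : 0 < ε) (hε₁ : ε ≤ 1) : ∃ K : ℕ,
    ∀ (Ω : Type v) (I : Type w) [Fintype Ω] (F : I → Ω → Prop), TraceBound D F →
    ∀ w : Ω → ℝ, (∀ ω, 0 ≤ w ω) → ∑ ω, w ω = 1 → ∃ S : Fin K → Ω, ∀ i, (∀ c, ¬ F i (S c)) →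
      (∑ ω, open Classical in if F i ω then w ω else 0) < ε := by
  obtain ⟨j, r, hjr, hD⟩ := exists_block_sizes D hε hε₁
  refine ⟨j * r, fun Ω I _ F hF w hw₀ hw => ?_⟩
  obtain ⟨S, hS⟩ := exists_blockNet hjr hD hF hw₀ hw
  refine ⟨fun c => S (finProdFinEquiv.symm c), fun i hi => hS i fun c => ?_⟩
  simpa using hi (finProdFinEquiv c)

/-! ### Minimax -/

/-- If no mixture works, the convex hull of the error vectors is disjoint from the orthant `{v | v ≤
δ}`, and Hahn-Banach separates them; the hull is compact because there are finitely many error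
vectors. The coefficients of the separating functional are nonpositive, and normalizing them yields
a probability measure for which every `b` has average error above `δ`. -/
theorem exists_mixture [Fintype Ω] {B : Type*} [Nonempty B] (err : B → Ω → ℝ)
    (hfin : (Set.range err).Finite) {δ : ℝ}
    (h : ∀ w : Ω → ℝ, (∀ ω, 0 ≤ w ω) → ∑ ω, w ω = 1 → ∃ b, ∑ ω, w ω * err b ω ≤ δ) :
    ∃ (ι : Type) (_ : Fintype ι) (ν : ι → ℝ) (b : ι → B), (∀ i, 0 ≤ ν i) ∧ ∑ i, ν i = 1 ∧
      ∀ ω, ∑ i, ν i * err (b i) ω ≤ δ := by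
  classical
  have key : ¬ Disjoint (convexHull ℝ (Set.range err)) {v | ∀ ω, v ω ≤ δ} := by
    intro hdisj
    have hconv : Convex ℝ {v : Ω → ℝ | ∀ ω, v ω ≤ δ} := by
      have : {v : Ω → ℝ | ∀ ω, v ω ≤ δ} = Set.Iic fun _ => δ := rfl
      exact this ▸ convex_Iic _
    have hclosed : IsClosed {v : Ω → ℝ | ∀ ω, v ω ≤ δ} := by
      have : {v : Ω → ℝ | ∀ ω, v ω ≤ δ} = Set.Iic fun _ => δ := rfl
      exact this ▸ isClosed_Iic
    obtain ⟨f, u, v, hf₁, huv, hf₂⟩ := geometric_hahn_banach_compact_closed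
      (convex_convexHull ℝ _) (Set.Finite.isCompact_convexHull ℝ hfin) hconv hclosed hdisj
    let e : Ω → Ω → ℝ := fun ω ω' => if ω = ω' then 1 else 0
    let c : Ω → ℝ := fun ω => f (e ω)
    have hf : ∀ z : Ω → ℝ, f z = ∑ ω, z ω * c ω :=
      LinearMap.pi_apply_eq_sum_univ f.toLinearMap
    -- The orthant is closed under decreasing a coordinate, so a positive coefficient would make `f`
    -- unbounded below on it.
    have hc : ∀ ω, c ω ≤ 0 := by
      intro ω
      by_contra! hpos
      obtain ⟨n, hn⟩ := exists_nat_gt ((f (fun _ => δ) - v) / c ω)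
      rw [div_lt_iff₀ hpos] at hn
      have hmem : (fun _ => δ) - (n : ℝ) • e ω ∈ {v : Ω → ℝ | ∀ ω, v ω ≤ δ} := by
        intro ω'
        have : (0 : ℝ) ≤ e ω ω' := by
          simp only [e]; split_ifs <;> norm_num
        simp only [Pi.sub_apply, Pi.smul_apply, smul_eq_mul]
        nlinarith [mul_nonneg (Nat.cast_nonneg (α := ℝ) n) this]
      have := hf₂ _ hmem
      rw [map_sub, map_smul, smul_eq_mul] at this
      change v < f (fun _ => δ) - n * c ω at this
      linarith
    have hδ := hf₂ (fun _ => δ) fun _ => le_rfl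
    rw [hf, ← mul_sum] at hδ
    have herr : ∀ b, f (err b) < u := fun b => hf₁ _ (subset_convexHull ℝ _ ⟨b, rfl⟩)
    simp only [hf] at herr
    have hneg : ∑ ω, c ω < 0 := by
      refine lt_of_le_of_ne (sum_nonpos fun ω _ => hc ω) fun h0 => ?_
      have hc0 : ∀ ω, c ω = 0 := fun ω =>
        (sum_eq_zero_iff_of_nonpos fun ω _ => hc ω).1 h0 ω (mem_univ ω)
      have := herr (Classical.arbitrary B)
      simp only [hc0, mul_zero, sum_const_zero] at this hδ
      linarith
    -- Dividing by the negative total makes the weights nonnegative and reverses the separating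
    -- inequality.
    obtain ⟨b, hb⟩ := h (fun ω => c ω / ∑ ω, c ω)
      (fun ω => div_nonneg_of_nonpos (hc ω) hneg.le) (by rw [← sum_div, div_self hneg.ne])
    have h₁ : ∑ ω, c ω / (∑ ω, c ω) * err b ω = (∑ ω, err b ω * c ω) / ∑ ω, c ω := by
      rw [sum_div]
      exact sum_congr rfl fun ω _ => by ring
    rw [h₁, div_le_iff_of_neg hneg] at hb
    linarith [herr b]
  obtain ⟨z, hz, hzδ⟩ := Set.not_disjoint_iff.1 key
  obtain ⟨ι, _, ν, y, hν₀, hν, hy, rfl⟩ := mem_convexHull_iff_exists_fintype.1 hz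
  choose b hb using hy
  refine ⟨Fin (Fintype.card ι), inferInstance, fun i => ν ((Fintype.equivFin ι).symm i),
    fun i => b ((Fintype.equivFin ι).symm i), fun i => hν₀ _, ?_, fun ω => ?_⟩
  · rw [← hν]
    exact Fintype.sum_equiv (Fintype.equivFin ι).symm _ _ fun _ => rfl
  · refine le_trans (le_of_eq ?_) (hzδ ω)
    simp only [Finset.sum_apply, Pi.smul_apply, smul_eq_mul, hb]
    exact Fintype.sum_equiv (Fintype.equivFin ι).symm _ _ fun _ => rfl

/-! ### Uniform separation of finite sets -/

/-- A `b` that is right on a `1/4`-net for the error sets errs with weight below `1/4`, so minimax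
applies. In the resulting mixture, a random `b` is right on both `p ∈ X` and `q ∈ Y`, hence
distinguishes them, with probability at least `1/2`. A `1/2`-net for the sets of `b` that
distinguish `p` from `q` thus meets all of these sets. The size of the second net depends only on
`k'`. -/
theorem exists_uniform_distinguishing (k k' : ℕ) : ∃ K N : ℕ,
    ∀ (P : Type v) (B : Type w) [Nonempty B] (r : P → B → Prop), NoShatter k r →
    NoShatter k' (fun b p => r p b) → ∀ X Y : Set P, X.Finite → Y.Finite →
    (∀ p : Fin K → P, ∃ b, ∀ i, (p i ∈ X → r (p i) b) ∧ (p i ∈ Y → ¬ r (p i) b)) →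
    ∃ b : Fin N → B, ∀ p ∈ X, ∀ q ∈ Y, ∃ i, ¬ (r p (b i) ↔ r q (b i)) := by
  classical
  obtain ⟨K, hK⟩ := exists_net.{v, w} k (ε := 1 / 4) (by norm_num) (by norm_num)
  obtain ⟨N, hN⟩ := exists_net.{0, v} (2 * k') (ε := 1 / 2) (by norm_num) (by norm_num)
  refine ⟨K, N, fun P B _ r hr hr' X Y hX hY hXY => ?_⟩
  have := (hX.union hY).fintype
  let wrong : B → ↥(X ∪ Y) → Prop := fun b ω =>
    ((ω : P) ∈ X ∧ ¬ r ω b) ∨ ((ω : P) ∈ Y ∧ r ω b)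
  have hwrong : TraceBound k wrong := by
    refine hr.traceBound.of_iff Subtype.val fun b b' ω h => ?_
    simp only [wrong, h]
  obtain ⟨ι, _, ν, b, hν₀, hν, hb⟩ := exists_mixture
    (fun b ω => if wrong b ω then (1 : ℝ) else 0)
    ((Set.Finite.pi' fun _ => Set.toFinite {0, 1}).subset (by
      rintro _ ⟨b, rfl⟩ ω
      by_cases h : wrong b ω <;> simp [h])) (δ := 1 / 4) (by
    intro w hw₀ hw
    obtain ⟨S, hS⟩ := hK _ _ wrong hwrong w hw₀ hw
    obtain ⟨b, hb⟩ := hXY fun i => S i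
    refine ⟨b, ?_⟩
    have := (hS b fun c => ?_).le
    · refine le_trans (le_of_eq (sum_congr rfl fun ω _ => ?_)) this
      by_cases h : wrong b ω <;> simp [h]
    · rintro (⟨h₁, h₂⟩ | ⟨h₁, h₂⟩)
      exacts [h₂ ((hb c).1 h₁), (hb c).2 h₁ h₂])
  obtain ⟨S, hS⟩ := hN ι (P × P) (fun pq i => ¬ (r pq.1 (b i) ↔ r pq.2 (b i)))
    ((hr'.traceBound.not_iff).of_iff b fun _ _ _ h => h) ν hν₀ hν
  refine ⟨fun i => b (S i), fun p hp q hq => ?_⟩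
  by_contra! hpq
  have hlt := hS (p, q) fun c => not_not.2 (hpq c)
  have hp' := hb ⟨p, .inl hp⟩
  have hq' := hb ⟨q, .inr hq⟩
  -- Each `b i` distinguishes `p` from `q`, or is wrong at `p`, or is wrong at `q`; the total weight
  -- would be less than `1/2 + 1/4 + 1/4`.
  have hsum : ∑ i, ν i ≤ (∑ i, if ¬ (r p (b i) ↔ r q (b i)) then ν i else 0) +
      ((∑ i, ν i * if wrong (b i) ⟨p, .inl hp⟩ then (1 : ℝ) else 0) +
        ∑ i, ν i * if wrong (b i) ⟨q, .inr hq⟩ then (1 : ℝ) else 0) := by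
    rw [← sum_add_distrib, ← sum_add_distrib]
    refine sum_le_sum fun i _ => ?_
    have := hν₀ i
    simp only [wrong, hp, hq, true_and]
    by_cases h₁ : r p (b i) <;> by_cases h₂ : r q (b i) <;> simp only [h₁, h₂] <;> simp <;>
      first | linarith | (split_ifs <;> linarith)
  have hlt' : (∑ i, if ¬ (r p (b i) ↔ r q (b i)) then ν i else 0) < 1 / 2 := by
    convert hlt
  rw [hν] at hsum
  linarith

end VC

namespace MSLanguage

variable {L : MSLanguage.{u}}

/-! ### Substitution -/

/-- Concatenation of assignments of bound variables. -/
def BVar.appendEnv {S : Type u} {C : S → Type w} {τ' : List S} (e' : ∀ r, BVar τ' r → C r) :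
    ∀ {τ : List S}, (∀ r, BVar τ r → C r) → ∀ r, BVar (τ ++ τ') r → C r
  | [], _ => e'
  | _ :: _, e => BVar.consEnv (e _ .zero) (BVar.appendEnv e' fun r i => e r (.succ i))

/-- A bound variable of a list, seen in a list extended on the right. -/
def BVar.left {S : Type u} {τ' : List S} : ∀ {τ : List S} {s : S}, BVar τ s → BVar (τ ++ τ') s
  | _, _, .zero => .zero
  | _, _, .succ i => .succ i.left

/-- A bound variable of a list, seen in a list extended on the left. -/
def BVar.right {S : Type u} {τ' : List S} : ∀ (τ : List S) {s : S}, BVar τ' s → BVar (τ ++ τ') s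
  | [], _, i => i
  | _ :: τ, _, i => .succ (BVar.right τ i)

theorem BVar.appendEnv_left {S : Type u} {C : S → Type w} {τ' : List S}
    (e' : ∀ r, BVar τ' r → C r) {τ : List S} (e : ∀ r, BVar τ r → C r) {s : S} (i : BVar τ s) :
    BVar.appendEnv e' e s i.left = e s i := by
  induction i with
  | zero => rfl
  | succ i ih => exact ih fun r i => e r (.succ i)

theorem BVar.appendEnv_right {S : Type u} {C : S → Type w} {τ' : List S}
    (e' : ∀ r, BVar τ' r → C r) {τ : List S} (e : ∀ r, BVar τ r → C r) {s : S} (i : BVar τ' s) :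
    BVar.appendEnv e' e s (BVar.right τ i) = e' s i := by
  induction τ with
  | nil => rfl
  | cons r τ ih => exact ih fun r i => e r (.succ i)

/-- This lets substitution pass under a quantifier: newly bound variables enter at the head of the
list, while the context `τ'` of the substituted terms stays at its end. -/
theorem BVar.consEnv_appendEnv {S : Type u} {C : S → Type w} {τ' : List S}
    (e' : ∀ r, BVar τ' r → C r) {τ : List S} (e : ∀ r, BVar τ r → C r) {s : S} (c : C s) :
    BVar.consEnv c (BVar.appendEnv e' e) = BVar.appendEnv e' (BVar.consEnv c e) := rfl

/-- Renaming of the bound variables of a term. -/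
def Term.rename {α : Type v} {σ : α → L.Srt} {τ τ' : List L.Srt}
    (f : ∀ r, BVar τ r → BVar τ' r) : ∀ {s : L.Srt}, L.Term σ τ s → L.Term σ τ' s
  | _, .fvar a => .fvar a
  | _, .bvar i => .bvar (f _ i)
  | _, .app g ts => .app g fun i => (ts i).rename f

theorem Term.eval_rename (M : Structure.{u, w} L) {α : Type v} {σ : α → L.Srt}
    {τ τ' : List L.Srt} (f : ∀ r, BVar τ r → BVar τ' r) (a : M.Tuple σ)
    (e : ∀ r, BVar τ' r → M.carrier r) {s : L.Srt} (t : L.Term σ τ s) :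
    (t.rename f).eval M a e = t.eval M a fun r i => e r (f r i) := by
  induction t with
  | fvar a => rfl
  | bvar i => rfl
  | app g ts ih => exact congrArg (M.funMap g) (funext ih)

/-- Substitution of terms for the free variables of a term. -/
def Term.subst {α β : Type v} {σ : α → L.Srt} {σ' : β → L.Srt} {τ' : List L.Srt}
    (f : ∀ a, L.Term σ' τ' (σ a)) {τ : List L.Srt} :
    ∀ {s : L.Srt}, L.Term σ τ s → L.Term σ' (τ ++ τ') s
  | _, .fvar a => (f a).rename fun _ => BVar.right τ
  | _, .bvar i => .bvar i.left
  | _, .app g ts => .app g fun i => (ts i).subst f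

theorem Term.eval_subst (M : Structure.{u, w} L) {α β : Type v} {σ : α → L.Srt} {σ' : β → L.Srt}
    {τ' : List L.Srt} (f : ∀ a, L.Term σ' τ' (σ a)) (a : M.Tuple σ')
    (e' : ∀ r, BVar τ' r → M.carrier r) {τ : List L.Srt} (e : ∀ r, BVar τ r → M.carrier r)
    {s : L.Srt} (t : L.Term σ τ s) :
    (t.subst f).eval M a (BVar.appendEnv e' e) = t.eval M (fun i => (f i).eval M a e') e := by
  induction t with
  | fvar b =>
    simp only [Term.subst, Term.eval_rename, BVar.appendEnv_right]
    rfl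
  | bvar i => exact BVar.appendEnv_left e' e i
  | app g ts ih => exact congrArg (M.funMap g) (funext ih)

/-- Substitution of terms for the free variables of a formula. -/
def BFormula.subst {α β : Type v} {σ : α → L.Srt} {σ' : β → L.Srt} {τ' : List L.Srt}
    (f : ∀ a, L.Term σ' τ' (σ a)) : ∀ {τ : List L.Srt}, L.BFormula σ τ → L.BFormula σ' (τ ++ τ')
  | _, .falsum => .falsum
  | _, .equal t₁ t₂ => .equal (t₁.subst f) (t₂.subst f)
  | _, .rel R ts => .rel R fun i => (ts i).subst f
  | _, .imp φ ψ => .imp (φ.subst f) (ψ.subst f)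
  | _, .all s φ => .all s (φ.subst f)

theorem BFormula.holds_subst (M : Structure.{u, w} L) {α β : Type v} {σ : α → L.Srt}
    {σ' : β → L.Srt} {τ' : List L.Srt} (f : ∀ a, L.Term σ' τ' (σ a)) (a : M.Tuple σ')
    (e' : ∀ r, BVar τ' r → M.carrier r) {τ : List L.Srt} (φ : L.BFormula σ τ)
    (e : ∀ r, BVar τ r → M.carrier r) :
    (φ.subst f).Holds M a (BVar.appendEnv e' e) ↔
      φ.Holds M (fun i => (f i).eval M a e') e := by
  induction φ with
  | falsum => rfl
  | equal t₁ t₂ => simp only [BFormula.subst, BFormula.Holds, Term.eval_subst]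
  | rel R ts => simp only [BFormula.subst, BFormula.Holds, Term.eval_subst]
  | imp φ ψ ih₁ ih₂ => simp only [BFormula.subst, BFormula.Holds, ih₁, ih₂]
  | all s φ ih =>
    simp only [BFormula.subst, BFormula.Holds]
    exact forall_congr' fun c => by rw [BVar.consEnv_appendEnv]; exact ih _

/-! ### Definable relations -/

/-- A function that is uniformly given by a term. -/
def IsTerm {α : Type v} (σ : α → L.Srt) {s : L.Srt}
    (h : ∀ M : Structure.{u, w} L, M.Tuple σ → M.carrier s) : Prop :=
  ∃ t : L.Term σ [] s, ∀ M a, t.eval M a BVar.nilEnv = h M a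

theorem IsTerm.var {α : Type v} {σ : α → L.Srt} (i : α) :
    IsTerm.{u, v, w} σ fun _ a => a i :=
  ⟨.fvar i, fun _ _ => rfl⟩

/-- A relation that is uniformly defined by a formula. -/
def Definable {α : Type v} (σ : α → L.Srt)
    (R : ∀ M : Structure.{u, w} L, M.Tuple σ → Prop) : Prop :=
  ∃ φ : L.Formula σ, ∀ M a, Formula.Realize M φ a ↔ R M a

namespace Definable

variable {α : Type v} {σ : α → L.Srt} {R R' : ∀ M : Structure.{u, w} L, M.Tuple σ → Prop}

theorem congr (h : Definable σ R) (hR : ∀ M a, R M a ↔ R' M a) : Definable σ R' := by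
  obtain ⟨φ, hφ⟩ := h
  exact ⟨φ, fun M a => (hφ M a).trans (hR M a)⟩

/-- With the closure properties below, this is the substitute for writing formulas out: a condition
is shown to be definable by following its logical structure. -/
theorem realize {β : Type v} {σ' : β → L.Srt} (φ : L.Formula σ')
    (g : ∀ M : Structure.{u, w} L, M.Tuple σ → M.Tuple σ')
    (hg : ∀ i, IsTerm σ fun M a => g M a i) :
    Definable σ fun M a => Formula.Realize M φ (g M a) := by
  choose f hf using hg
  refine ⟨BFormula.subst f φ, fun M a => ?_⟩
  have := BFormula.holds_subst M f a BVar.nilEnv φ BVar.nilEnv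
  simp only [hf] at this
  exact this

theorem comp {β : Type v} {σ' : β → L.Srt} {Q : ∀ M : Structure.{u, w} L, M.Tuple σ' → Prop}
    (h : Definable σ' Q) (g : ∀ M : Structure.{u, w} L, M.Tuple σ → M.Tuple σ')
    (hg : ∀ i, IsTerm σ fun M a => g M a i) : Definable σ fun M a => Q M (g M a) := by
  obtain ⟨φ, hφ⟩ := h
  exact (realize φ g hg).congr fun M a => hφ M _

theorem eq {s : L.Srt} {h₁ h₂ : ∀ M : Structure.{u, w} L, M.Tuple σ → M.carrier s}
    (H₁ : IsTerm σ h₁) (H₂ : IsTerm σ h₂) : Definable σ fun M a => h₁ M a = h₂ M a := by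
  obtain ⟨t₁, ht₁⟩ := H₁
  obtain ⟨t₂, ht₂⟩ := H₂
  exact ⟨.equal t₁ t₂, fun M a => iff_of_eq (congrArg₂ Eq (ht₁ M a) (ht₂ M a))⟩

theorem false : Definable.{u, v, w} σ fun _ _ => False :=
  ⟨.falsum, fun _ _ => Iff.rfl⟩

theorem imp (h : Definable σ R) (h' : Definable σ R') :
    Definable σ fun M a => R M a → R' M a := by
  obtain ⟨φ, hφ⟩ := h
  obtain ⟨ψ, hψ⟩ := h'
  exact ⟨.imp φ ψ, fun M a => imp_congr (hφ M a) (hψ M a)⟩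

theorem not (h : Definable σ R) : Definable σ fun M a => ¬ R M a :=
  h.imp false

theorem and (h : Definable σ R) (h' : Definable σ R') :
    Definable σ fun M a => R M a ∧ R' M a :=
  (h.imp h'.not).not.congr fun M a => by tauto

theorem iff (h : Definable σ R) (h' : Definable σ R') :
    Definable σ fun M a => (R M a ↔ R' M a) :=
  ((h.imp h').and (h'.imp h)).congr fun _ _ => iff_def.symm

theorem const (p : Prop) : Definable.{u, v, w} σ fun _ _ => p := by
  by_cases hp : p
  · exact (false.imp false).congr fun _ _ => by tauto
  · exact false.congr fun _ _ => by tauto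

theorem forall_finite {ι : Type*} [Finite ι]
    {Q : ι → ∀ M : Structure.{u, w} L, M.Tuple σ → Prop} (h : ∀ i, Definable σ (Q i)) :
    Definable σ fun M a => ∀ i, Q i M a := by
  have key : ∀ l : List ι, Definable σ fun M a => ∀ i ∈ l, Q i M a := by
    intro l
    induction l with
    | nil => exact (const True).congr fun M a => by simp
    | cons i l ih => exact ((h i).and ih).congr fun M a => by simp
  have := Fintype.ofFinite ι
  exact (key Finset.univ.toList).congr fun M a => by simp

theorem exists_finite {ι : Type*} [Finite ι]
    {Q : ι → ∀ M : Structure.{u, w} L, M.Tuple σ → Prop} (h : ∀ i, Definable σ (Q i)) :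
    Definable σ fun M a => ∃ i, Q i M a :=
  (forall_finite fun i => (h i).not).not.congr fun M a => by simp

end Definable

/-- The assignment to bound variables given by a list of values. -/
def BVar.listEnv {S : Type u} {C : S → Type w} {β : Type v} {τ : β → S} (b : ∀ j, C (τ j)) :
    ∀ l : List β, ∀ r, BVar (l.map τ) r → C r
  | [] => BVar.nilEnv
  | j :: l => BVar.consEnv (b j) (BVar.listEnv b l)

theorem BVar.exists_listEnv_eq {S : Type u} {β : Type v} {τ : β → S} {l : List β} {j : β}
    (hj : j ∈ l) : ∃ i : BVar (l.map τ) (τ j), ∀ (C : S → Type w) (b : ∀ j, C (τ j)),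
      BVar.listEnv b l _ i = b j := by
  induction hj with
  | head l => exact ⟨.zero, fun _ _ => rfl⟩
  | tail k _ ih =>
    obtain ⟨i, hi⟩ := ih
    exact ⟨.succ i, hi⟩

theorem BFormula.exists_forall_env {α : Type v} {σ : α → L.Srt} (τ : List L.Srt)
    (φ : L.BFormula σ τ) : ∃ ψ : L.Formula σ, ∀ (M : Structure.{u, w} L) a,
      Formula.Realize M ψ a ↔ ∀ e, φ.Holds M a e := by
  induction τ with
  | nil =>
    refine ⟨φ, fun M a => ⟨fun h e => ?_, fun h => h _⟩⟩
    have : e = BVar.nilEnv := by funext r i; exact nomatch i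
    rwa [this]
  | cons s τ ih =>
    obtain ⟨ψ, hψ⟩ := ih (.all s φ)
    refine ⟨ψ, fun M a => (hψ M a).trans ⟨fun h e => ?_, fun h e c => h _⟩⟩
    have := h (fun r i => e r (.succ i)) (e _ .zero)
    convert this using 1
    funext r i
    cases i <;> rfl

namespace Definable

variable {α β : Type v} {σ : α → L.Srt} {τ : β → L.Srt}

/-- The variables `Sum.inr j` are turned into bound variables and then quantified one by one. Every
tuple `b` arises from an assignment of these bound variables, read off at the positions `p j`, which
do not depend on the structure. -/
theorem forall_tuple [Finite β] {R : ∀ M : Structure.{u, w} L, M.Tuple σ → M.Tuple τ → Prop}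
    (h : Definable (Sum.elim σ τ) fun M c => R M (fun i => c (.inl i)) fun j => c (.inr j)) :
    Definable σ fun M a => ∀ b, R M a b := by
  have := Fintype.ofFinite β
  obtain ⟨φ, hφ⟩ := h
  choose p hp using fun j : β =>
    BVar.exists_listEnv_eq.{u, v, w} (τ := τ) (Finset.mem_toList.2 (Finset.mem_univ j))
  let f : ∀ c, L.Term σ (Finset.univ.toList.map τ) (Sum.elim σ τ c)
    | .inl i => .fvar i
    | .inr j => .bvar (p j)
  obtain ⟨ψ, hψ⟩ := BFormula.exists_forall_env.{u, v, w} _ (φ.subst f)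
  refine ⟨ψ, fun M a => (hψ M a).trans ?_⟩
  have key : ∀ e, (φ.subst f).Holds M a e ↔ R M a fun j => e _ (p j) := fun e =>
    (BFormula.holds_subst M f a e φ BVar.nilEnv).trans (hφ M fun c => (f c).eval M a e)
  simp only [key]
  refine ⟨fun h b => ?_, fun h e => h _⟩
  have := h (BVar.listEnv b Finset.univ.toList)
  simp only [hp] at this
  exact this

theorem exists_tuple [Finite β] {R : ∀ M : Structure.{u, w} L, M.Tuple σ → M.Tuple τ → Prop}
    (h : Definable (Sum.elim σ τ) fun M c => R M (fun i => c (.inl i)) fun j => c (.inr j)) :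
    Definable σ fun M a => ∃ b, R M a b :=
  (forall_tuple (R := fun M a b => ¬ R M a b) h.not).not.congr fun M a => by simp

/-- A change of variables by which every tuple can be recovered. -/
theorem exists_realize {R : ∀ M : Structure.{u, w} L, M.Tuple σ → Prop} (h : Definable σ R)
    (g : ∀ M : Structure.{u, w} L, M.Tuple σ → M.Tuple τ)
    (hg : ∀ i, ∃ t : L.Term τ [] (σ i), ∀ M a, t.eval M (g M a) BVar.nilEnv = a i) :
    ∃ φ : L.Formula τ, ∀ (M : Structure.{u, w} L) (a : M.Tuple σ),
      Formula.Realize M φ (g M a) ↔ R M a := by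
  obtain ⟨φ, hφ⟩ := h
  choose f hf using hg
  refine ⟨BFormula.subst f φ, fun M a => ?_⟩
  have := BFormula.holds_subst M f (g M a) BVar.nilEnv φ BVar.nilEnv
  simp only [hf] at this
  exact this.trans (hφ M a)

theorem reindex {R : ∀ M : Structure.{u, w} L, M.Tuple σ → Prop} (h : Definable σ R)
    {f : β → α} (hf : f.Surjective) :
    ∃ φ : L.Formula fun i => σ (f i), ∀ (M : Structure.{u, w} L) (a : M.Tuple σ),
      Formula.Realize M φ (fun i => a (f i)) ↔ R M a :=
  h.exists_realize (fun _ a i => a (f i)) fun i => by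
    obtain ⟨j, rfl⟩ := hf i
    exact ⟨.fvar j, fun _ _ => rfl⟩

end Definable

/-! ### Formulas in an enriched language -/

namespace Enrichment

variable (E : L.Enrichment)

theorem eval_liftTerm (M : Structure.{u, w} E.lang) {α : Type v} {σ : α → L.Srt}
    (a : (E.reduct M).Tuple σ) {τ : List L.Srt}
    (e : ∀ r, BVar (S := E.lang.Srt) (τ.map Sum.inl) r → M.carrier r) {s : L.Srt}
    (t : L.Term σ τ s) :
    (E.liftTerm t).eval M a e = t.eval (E.reduct M) a fun _ i => e _ (E.liftBVar i) := by
  induction t with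
  | fvar a => rfl
  | bvar i => rfl
  | app g ts ih => exact congrArg (M.funMap (.inl g)) (funext ih)

theorem holds_liftFormula (M : Structure.{u, w} E.lang) {α : Type v} {σ : α → L.Srt}
    (a : (E.reduct M).Tuple σ) {τ : List L.Srt} (φ : L.BFormula σ τ)
    (e : ∀ r, BVar (S := E.lang.Srt) (τ.map Sum.inl) r → M.carrier r) :
    (E.liftFormula φ).Holds M a e ↔ φ.Holds (E.reduct M) a fun _ i => e _ (E.liftBVar i) := by
  induction φ with
  | falsum => rfl
  | equal t₁ t₂ => simp only [liftFormula, BFormula.Holds, eval_liftTerm]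
  | rel R ts =>
    simp only [liftFormula, BFormula.Holds]
    refine iff_of_eq (congrArg (M.relMap (.inl R)) (funext fun i => ?_))
    exact eval_liftTerm E M a e (ts i)
  | imp φ ψ ih₁ ih₂ => simp only [liftFormula, BFormula.Holds, ih₁, ih₂]
  | all s φ ih =>
    simp only [liftFormula, BFormula.Holds]
    refine forall_congr' fun c => (ih _).trans (iff_of_eq ?_)
    congr 1
    funext r i
    cases i <;> rfl

theorem realize_liftFormula (M : Structure.{u, w} E.lang) {α : Type v} {σ : α → L.Srt}
    (a : (E.reduct M).Tuple σ) (φ : L.Formula σ) :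
    Formula.Realize M (E.liftFormula φ) a ↔ Formula.Realize (E.reduct M) φ a := by
  refine (E.holds_liftFormula M a φ BVar.nilEnv).trans (iff_of_eq ?_)
  unfold Formula.Realize
  congr 1
  funext r i
  cases i

theorem realize_liftSentence (M : Structure.{u, w} E.lang) (ψ : L.Sentence) :
    Formula.Realize M (E.liftSentence ψ) M.emptyTuple ↔
      Formula.Realize (E.reduct M) ψ (E.reduct M).emptyTuple := by
  rw [← realize_liftFormula]
  -- Generalizing the sort assignment allows the cast in `liftSentence` to be eliminated.
  have key : ∀ (σ : Empty → E.lang.Srt) (h : (fun i => Sum.inl (Empty.elim i)) = σ)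
      (a : M.Tuple σ), Formula.Realize M
        (cast (congrArg (fun σ : Empty → E.lang.Srt => E.lang.Formula σ) h) (E.liftFormula ψ)) a ↔
      Formula.Realize M (E.liftFormula ψ) (E.reduct M).emptyTuple := by
    rintro σ rfl a
    have : a = (E.reduct M).emptyTuple := funext fun i => i.elim
    rw [this]
    rfl
  exact key _ (Subsingleton.elim _ _) _

theorem reduct_models {T : L.Theory} {T' : E.lang.Theory} (h : ∀ ψ ∈ T, E.liftSentence ψ ∈ T')
    {M : Structure.{u, w} E.lang} (hM : M.Models T') : (E.reduct M).Models T :=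
  fun ψ hψ => (E.realize_liftSentence M ψ).1 (hM _ (h ψ hψ))

/-- A relation definable in `L` is definable in the enriched language. -/
theorem definable_reduct {α β : Type v} {σ : α → L.Srt} {σ' : β → E.lang.Srt}
    {R : ∀ M : Structure.{u, w} L, M.Tuple σ → Prop} (h : Definable σ R)
    (g : ∀ M : Structure.{u, w} E.lang, M.Tuple σ' → M.Tuple (fun i => Sum.inl (σ i)))
    (hg : ∀ i, IsTerm σ' fun M a => g M a i) :
    Definable σ' fun M a => R (E.reduct M) (g M a) := by
  obtain ⟨φ, hφ⟩ := h
  exact (Definable.realize (E.liftFormula φ) g hg).congr fun M a =>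
    (E.realize_liftFormula M _ φ).trans (hφ _ _)

end Enrichment

/-! ### Ultraproducts -/

/-- The ultraproduct of a family of structures. -/
noncomputable def ultraproduct {I : Type v} (U : Ultrafilter I) (M : I → Structure.{u, w} L) :
    Structure.{u, max v w} L where
  carrier := fun s => Quotient (Filter.productSetoid (U : Filter I) fun i => (M i).carrier s)
  nonempty := fun s => ⟨Quotient.mk _ fun i => Classical.choice ((M i).nonempty s)⟩
  funMap := fun f a => Quotient.mk _ fun i => (M i).funMap f fun j => (a j).out i
  relMap := fun R a => ∀ᶠ i in (U : Filter I), (M i).relMap R fun j => (a j).out i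

section Los

variable {I : Type v} (U : Ultrafilter I) (M : I → Structure.{u, w} L)

/-- The element of the ultraproduct that is represented by a family of elements. -/
def ultraMk {s : L.Srt} (c : ∀ i, (M i).carrier s) : (ultraproduct U M).carrier s :=
  Quotient.mk _ c

theorem ultraMk_surjective (s : L.Srt) :
    Function.Surjective (ultraMk U M : (∀ i, (M i).carrier s) → _) :=
  Quotient.mk_surjective

theorem ultraMk_eq_iff {s : L.Srt} (c d : ∀ i, (M i).carrier s) :
    ultraMk U M c = ultraMk U M d ↔ ∀ᶠ i in (U : Filter I), c i = d i :=
  Quotient.eq (r := Filter.productSetoid (U : Filter I) fun i => (M i).carrier s)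

theorem eventually_out_ultraMk {s : L.Srt} (c : ∀ i, (M i).carrier s) :
    ∀ᶠ i in (U : Filter I), Quotient.out (ultraMk U M c) i = c i :=
  (ultraMk_eq_iff U M _ _).1 (Quotient.out_eq (ultraMk U M c))

theorem eval_ultraproduct {α : Type*} {σ : α → L.Srt} {τ : List L.Srt}
    (a : ∀ k i, (M i).carrier (σ k)) (e : ∀ r, BVar τ r → ∀ i, (M i).carrier r)
    {s : L.Srt} (t : L.Term σ τ s) :
    t.eval (ultraproduct U M) (fun k => ultraMk U M (a k)) (fun r v => ultraMk U M (e r v)) =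
      ultraMk U M fun i => t.eval (M i) (fun k => a k i) fun r v => e r v i := by
  induction t with
  | fvar k => rfl
  | bvar v => rfl
  | app f ts ih =>
    simp only [Term.eval, ih]
    refine (ultraMk_eq_iff U M _ _).2 ?_
    -- Functions act on chosen representatives; as the arity is finite, these agree with the given
    -- ones in all arguments at once on a set of the ultrafilter.
    filter_upwards [Filter.eventually_all.2 fun j => eventually_out_ultraMk U M fun i =>
      (ts j).eval (M i) (fun k => a k i) fun r v => e r v i] with i hi
    exact congrArg ((M i).funMap f) (funext hi)

theorem BVar.consEnv_apply {S : Type u} {C D : S → Type*} {s : S} {τ : List S}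
    (g : ∀ r, C r → D r) (c : C s) (e : ∀ r, BVar τ r → C r) :
    BVar.consEnv (g s c) (fun r v => g r (e r v)) = fun r v => g r (BVar.consEnv c e r v) := by
  funext r v
  cases v <;> rfl

/-- Łoś's theorem, by induction on the formula. The quantifier step picks a counterexample in each
factor that has one. -/
theorem holds_ultraproduct {α : Type*} {σ : α → L.Srt} {τ : List L.Srt}
    (φ : L.BFormula σ τ)
    (a : ∀ k i, (M i).carrier (σ k)) (e : ∀ r, BVar τ r → ∀ i, (M i).carrier r) :
    φ.Holds (ultraproduct U M) (fun k => ultraMk U M (a k)) (fun r v => ultraMk U M (e r v)) ↔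
      ∀ᶠ i in (U : Filter I), φ.Holds (M i) (fun k => a k i) fun r v => e r v i := by
  induction φ with
  | falsum => simpa [BFormula.Holds] using U.neBot.ne
  | equal t₁ t₂ =>
    simp only [BFormula.Holds, eval_ultraproduct]
    exact ultraMk_eq_iff U M _ _
  | rel R ts =>
    simp only [BFormula.Holds, eval_ultraproduct]
    refine Filter.eventually_congr ?_
    filter_upwards [Filter.eventually_all.2 fun j => eventually_out_ultraMk U M fun i =>
      (ts j).eval (M i) (fun k => a k i) fun r v => e r v i] with i hi
    exact iff_of_eq (congrArg ((M i).relMap R) (funext hi))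
  | imp φ ψ ih₁ ih₂ => simp only [BFormula.Holds, ih₁, ih₂, Ultrafilter.eventually_imp]
  | all s φ ih =>
    simp only [BFormula.Holds]
    have key : ∀ c : ∀ i, (M i).carrier s,
        φ.Holds (ultraproduct U M) (fun k => ultraMk U M (a k))
          (BVar.consEnv (ultraMk U M c) fun r v => ultraMk U M (e r v)) ↔
        ∀ᶠ i in (U : Filter I), φ.Holds (M i) (fun k => a k i)
          (BVar.consEnv (c i) fun r v => e r v i) := by
      intro c
      rw [BVar.consEnv_apply (C := fun r => ∀ i, (M i).carrier r) (fun r => ultraMk U M), ih]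
      refine iff_of_eq (congrArg (fun p => Filter.Eventually p (U : Filter I)) (funext fun i => ?_))
      rw [← BVar.consEnv_apply (C := fun r => ∀ i, (M i).carrier r)
        (D := (M i).carrier) (fun r c => c i)]
    rw [(ultraMk_surjective U M s).forall]
    simp only [key]
    constructor
    · intro h
      by_contra hn
      rw [← Ultrafilter.eventually_not] at hn
      have hc : ∀ i, ∃ c, (¬ ∀ c, φ.Holds (M i) (fun k => a k i)
          (BVar.consEnv c fun r v => e r v i)) →
          ¬ φ.Holds (M i) (fun k => a k i) (BVar.consEnv c fun r v => e r v i) := by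
        intro i
        have := (M i).nonempty s
        by_cases hi : ∀ c, φ.Holds (M i) (fun k => a k i) (BVar.consEnv c fun r v => e r v i)
        -- Factors without a counterexample receive an arbitrary element, which exists because sorts
        -- are nonempty.
        · exact ⟨Classical.choice this, fun hn => absurd hi hn⟩
        · obtain ⟨c, hc⟩ := not_forall.1 hi
          exact ⟨c, fun _ => hc⟩
      choose c hc using hc
      obtain ⟨i, h₁, h₂⟩ := ((h c).and hn).exists
      exact hc i h₂ h₁
    · intro h c
      filter_upwards [h] with i hi using hi _

theorem realize_ultraproduct {α : Type*} {σ : α → L.Srt} (φ : L.Formula σ)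
    (a : ∀ k i, (M i).carrier (σ k)) :
    Formula.Realize (ultraproduct U M) φ (fun k => ultraMk U M (a k)) ↔
      ∀ᶠ i in (U : Filter I), Formula.Realize (M i) φ fun k => a k i := by
  have h₁ : (BVar.nilEnv : ∀ r, BVar [] r → (ultraproduct U M).carrier r) =
      fun r v => ultraMk U M (BVar.nilEnv (C := fun r => ∀ i, (M i).carrier r) r v) := by
    funext r v; cases v
  have h₂ : ∀ i, (BVar.nilEnv : ∀ r, BVar [] r → (M i).carrier r) =
      fun r v => BVar.nilEnv (C := fun r => ∀ i, (M i).carrier r) r v i := by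
    intro i; funext r v; cases v
  unfold Formula.Realize
  rw [h₁, holds_ultraproduct]
  simp only [h₂]

theorem ultraproduct_models {T : L.Theory} (h : ∀ i, (M i).Models T) :
    (ultraproduct U M).Models T := by
  intro ψ hψ
  have h₁ : (ultraproduct U M).emptyTuple = fun k => ultraMk U M (k.elim : ∀ i, (M i).carrier _) :=
    funext fun k => k.elim
  rw [h₁, realize_ultraproduct]
  refine Filter.Eventually.of_forall fun i => ?_
  convert h i ψ hψ

end Los

/-- The universes are such that the ultraproduct is again one of the structures in which `R` is
evaluated. -/
theorem Definable.ultraproduct_iff {I : Type u} (U : Ultrafilter I)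
    (M : I → Structure.{u, max u w} L) {α : Type v} {σ : α → L.Srt}
    {R : ∀ M : Structure.{u, max u w} L, M.Tuple σ → Prop} (h : Definable σ R)
    (a : ∀ k i, (M i).carrier (σ k)) :
    R (ultraproduct.{u, u, max u w} U M) (fun k => ultraMk U M (a k)) ↔
      ∀ᶠ i in (U : Filter I), R (M i) fun k => a k i := by
  obtain ⟨φ, hφ⟩ := h
  simp only [← hφ]
  exact realize_ultraproduct U M φ a

/-! ### Elementary extensions and external separability -/

/-- The diagonal embedding into an ultrapower. -/
def diagonal {I : Type w} (U : Ultrafilter I) (M : Structure.{u, w} L) :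
    ElementaryEmbedding M (ultraproduct.{u, w, w} U fun _ => M) where
  toFun := fun _ c => ultraMk U (fun _ => M) fun _ => c
  map_formula := fun _ φ a =>
    (realize_ultraproduct U (fun _ => M) φ fun k _ => a k).trans Filter.eventually_const

/-- Elementarity is stated for variables indexed by `Fin n`; reindexing extends it to any finite
index type. -/
theorem ElementaryEmbedding.map_definable {M N : Structure.{u, w} L} (j : ElementaryEmbedding M N)
    {α : Type} [Finite α] {σ : α → L.Srt} {R : ∀ M : Structure.{u, w} L, M.Tuple σ → Prop}
    (h : Definable σ R) (a : M.Tuple σ) : R N (fun i => j.toFun _ (a i)) ↔ R M a := by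
  obtain ⟨n, ⟨e⟩⟩ := Finite.exists_equiv_fin α
  obtain ⟨φ, hφ⟩ := h.reindex e.symm.surjective
  rw [← hφ, ← hφ]
  exact j.map_formula _ φ fun i => a (e.symm i)

/-- Every finite subset of `X` can be `φ`-separated from every finite subset of `Y`. -/
def FinitelySeparable (M : Structure.{u, w} L) {n m : ℕ} {x : Fin n → L.Srt}
    {t : Fin m → L.Srt} (φ : L.PFormula x t) (X Y : Set (M.Tuple x)) : Prop :=
  ∀ X₀ Y₀ : Set (M.Tuple x), X₀.Finite → Y₀.Finite → X₀ ⊆ X → Y₀ ⊆ Y → Separable M φ X₀ Y₀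

/-- Compactness through an ultrapower indexed by the finite sets `F` of tuples: parameters
separating `X ∩ F` from `Y ∩ F` are glued to one parameter of the ultrapower. -/
theorem FinitelySeparable.externallySeparable {M : Structure.{u, w} L} {n m : ℕ}
    {x : Fin n → L.Srt} {t : Fin m → L.Srt} {φ : L.PFormula x t} {X Y : Set (M.Tuple x)}
    (h : FinitelySeparable M φ X Y) : ExternallySeparable M φ X Y := by
  classical
  have hb : ∀ F : Finset (M.Tuple x), Separable M φ {a ∈ X | a ∈ F} {a ∈ Y | a ∈ F} := fun F =>
    h _ _ (F.finite_toSet.subset fun a ha => ha.2) (F.finite_toSet.subset fun a ha => ha.2)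
      (fun a ha => ha.1) fun a ha => ha.1
  choose b hbX hbY using hb
  let U : Ultrafilter (Finset (M.Tuple x)) := Ultrafilter.of Filter.atTop
  have hU : ∀ a, ∀ᶠ F in (U : Filter (Finset (M.Tuple x))), a ∈ F := fun a =>
    Ultrafilter.of_le _ ((Filter.eventually_ge_atTop {a}).mono fun F hF => hF (by simp))
  have key : ∀ a, Formula.Realize (ultraproduct.{u, w, w} U fun _ => M) φ
      (Structure.pair _ (fun i => (diagonal U M).toFun _ (a i))
        fun k => ultraMk U (fun _ => M) fun F => b F k) ↔
      ∀ᶠ F in (U : Filter (Finset (M.Tuple x))), Formula.Realize M φ (M.pair a (b F)) := by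
    intro a
    refine Iff.trans (iff_of_eq ?_) ((realize_ultraproduct U (fun _ => M) φ
      fun k F => M.pair a (b F) k))
    congr 1
    funext k
    cases k <;> rfl
  refine ⟨ultraproduct.{u, w, w} U fun _ => M, diagonal U M,
    fun k => ultraMk U (fun _ => M) fun F => b F k, fun a ha => (key a).2 ?_, ?_⟩
  · filter_upwards [hU a] with F hF using hbX F ⟨ha, hF⟩
  · refine Set.eq_empty_of_forall_notMem fun a ha => ?_
    obtain ⟨F, h₁, h₂⟩ := (((key a).1 ha.2).and (hU a)).exists
    exact Set.eq_empty_iff_forall_notMem.1 (hbY F) a ⟨⟨ha.1, h₂⟩, h₁⟩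

/-- Among any `K` points, a single instance of `φ` contains those of `X` and none of those of
`Y`. -/
def SeparatesTuples (M : Structure.{u, w} L) {n m : ℕ} {x : Fin n → L.Srt}
    {t : Fin m → L.Srt} (φ : L.PFormula x t) (K : ℕ) (X Y : Set (M.Tuple x)) : Prop :=
  ∀ p : Fin K → M.Tuple x, ∃ b : M.Tuple t, ∀ i,
    (p i ∈ X → p i ∈ PFormula.solSet M φ b) ∧ (p i ∈ Y → p i ∉ PFormula.solSet M φ b)

/-- `X` and `Y` need not be definable, so the pattern of which points are to be contained or omitted
is fixed outside the formula. The existence of a parameter then descends along elementary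
embeddings. -/
theorem definable_exists_separating {n m : ℕ} {x : Fin n → L.Srt}
    {t : Fin m → L.Srt} (φ : L.PFormula x t) (K : ℕ) (I J : Fin K → Prop) :
    Definable (fun i : Fin K × Fin n => x i.2)
      fun (M : Structure.{u, w} L) c => ∃ b : M.Tuple t, ∀ i : Fin K,
        (I i → Formula.Realize M φ (M.pair (fun j => c (i, j)) b)) ∧
        (J i → ¬ Formula.Realize M φ (M.pair (fun j => c (i, j)) b)) := by
  have h : ∀ i : Fin K, Definable
      (Sum.elim (fun i : Fin K × Fin n => x i.2) t) fun (M : Structure.{u, w} L) c =>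
        Formula.Realize M φ (M.pair (fun j => c (Sum.inl (i, j))) fun k => c (Sum.inr k)) := by
    intro i
    refine Definable.realize φ (fun M (c : M.Tuple (Sum.elim (fun i : Fin K × Fin n => x i.2) t)) =>
      M.pair (fun j => c (.inl (i, j))) fun k => c (.inr k)) ?_
    rintro (j | j) <;> exact IsTerm.var _
  exact Definable.exists_tuple (Definable.forall_finite fun i =>
    ((Definable.const _).imp (h i)).and ((Definable.const _).imp (h i).not))

theorem ExternallySeparable.separatesTuples {M : Structure.{u, w} L} {n m : ℕ} {x : Fin n → L.Srt}
    {t : Fin m → L.Srt} {φ : L.PFormula x t} {X Y : Set (M.Tuple x)}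
    (h : ExternallySeparable M φ X Y) (K : ℕ) : SeparatesTuples M φ K X Y := by
  obtain ⟨N, j, b, hX, hY⟩ := h
  intro p
  exact (j.map_definable (definable_exists_separating φ K (fun i => p i ∈ X) fun i => p i ∈ Y)
    fun i => p i.1 i.2).1 ⟨b, fun i => ⟨fun hi => hX hi, fun hi h =>
      Set.eq_empty_iff_forall_notMem.1 hY (p i) ⟨hi, h⟩⟩⟩

theorem finitelySeparable_of_separatesTuples {M : Structure.{u, w} L} {n m : ℕ}
    {x : Fin n → L.Srt} {t : Fin m → L.Srt} {φ : L.PFormula x t} {X Y : Set (M.Tuple x)}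
    (h : ∀ K, SeparatesTuples M φ K X Y) : FinitelySeparable M φ X Y := by
  intro X₀ Y₀ hX₀ hY₀ hX hY
  have := (hX₀.union hY₀).to_subtype
  obtain ⟨K, ⟨e⟩⟩ := Finite.exists_equiv_fin ↥(X₀ ∪ Y₀)
  obtain ⟨b, hb⟩ := h K fun i => e.symm i
  refine ⟨b, fun a ha => ?_, Set.eq_empty_of_forall_notMem fun a ha => ?_⟩
  · have := (hb (e ⟨a, .inl ha⟩)).1
    rw [e.symm_apply_apply] at this
    exact this (hX ha)
  · have := (hb (e ⟨a, .inr ha.1⟩)).2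
    rw [e.symm_apply_apply] at this
    exact this (hY ha.1) ha.2

theorem SeparatesTuples.mono {M : Structure.{u, w} L} {n m : ℕ} {x : Fin n → L.Srt}
    {t : Fin m → L.Srt} {φ : L.PFormula x t} {K : ℕ} {X Y X₀ Y₀ : Set (M.Tuple x)}
    (h : SeparatesTuples M φ K X Y) (hX : X₀ ⊆ X) (hY : Y₀ ⊆ Y) :
    SeparatesTuples M φ K X₀ Y₀ := fun p => by
  obtain ⟨b, hb⟩ := h p
  exact ⟨b, fun i => ⟨fun hi => (hb i).1 (hX hi), fun hi => (hb i).2 (hY hi)⟩⟩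

/-! ### Combinations of formulas -/

theorem separable_iff {M : Structure.{u, w} L} {n m : ℕ} {x : Fin n → L.Srt}
    {t : Fin m → L.Srt} {φ : L.PFormula x t} {X Y : Set (M.Tuple x)} :
    Separable M φ X Y ↔ ∃ b : M.Tuple t, ∀ a, (a ∈ X → Formula.Realize M φ (M.pair a b)) ∧
      (a ∈ Y → ¬ Formula.Realize M φ (M.pair a b)) :=
  exists_congr fun _ => ⟨fun h a => ⟨fun ha => h.1 ha, fun ha ha' =>
    Set.eq_empty_iff_forall_notMem.1 h.2 a ⟨ha, ha'⟩⟩, fun h => ⟨fun a ha => (h a).1 ha,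
    Set.eq_empty_of_forall_notMem fun a ha => (h a).2 ha.1 ha.2⟩⟩

/-- A definable relation with finitely many parameters can be used like a partitioned formula. -/
theorem Definable.exists_pformula {n : ℕ} {x : Fin n → L.Srt} {β : Type} [Finite β]
    {t : β → L.Srt} {R : ∀ M : Structure.{u, w} L, M.Tuple (Sum.elim x t) → Prop}
    (h : Definable (Sum.elim x t) R) : ∃ (k : ℕ) (z : Fin k → L.Srt) (ξ : L.PFormula x z),
      ∀ (M : Structure.{u, w} L) (b : M.Tuple t), ∃ c : M.Tuple z, ∀ a : M.Tuple x,
        Formula.Realize M ξ (M.pair a c) ↔ R M (M.pair a b) := by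
  obtain ⟨k, ⟨e⟩⟩ := Finite.exists_equiv_fin β
  obtain ⟨ξ, hξ⟩ := h.exists_realize (τ := Sum.elim x fun i => t (e.symm i))
    (fun M c => M.pair (fun i => c (.inl i)) fun i => c (.inr (e.symm i))) (by
      rintro (i | i)
      · exact ⟨.fvar (σ := Sum.elim x fun i => t (e.symm i)) (.inl i), fun _ _ => rfl⟩
      · obtain ⟨j, rfl⟩ := e.symm.surjective i
        exact ⟨.fvar (σ := Sum.elim x fun i => t (e.symm i)) (.inr j), fun _ _ => rfl⟩)
  exact ⟨k, _, ξ, fun M b => ⟨fun i => b (e.symm i), fun a => hξ M (M.pair a b)⟩⟩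

/-- Finitely many formulas can be combined to a single one, in the presence of a sort with two
elements. -/
theorem exists_combination (s₀ : L.Srt) {n : ℕ} {x : Fin n → L.Srt} {ι : Type} [Finite ι]
    (m : ι → ℕ) (z : ∀ i, Fin (m i) → L.Srt) (ξ : ∀ i, L.PFormula x (z i)) :
    ∃ (k : ℕ) (z' : Fin k → L.Srt) (ψ : L.PFormula x z'), ∀ M : Structure.{u, w} L,
      Nontrivial (M.carrier s₀) → ∀ (X Y : Set (M.Tuple x)) (i : ι),
        Separable M (ξ i) X Y → Separable M ψ X Y := by
  classical
  -- Besides the parameters of all `ξ i`, there is a selector: elements of sort `s₀` indexed by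
  -- `Option ι`. The disjunct `i` is active iff the entry at `some i` equals the entry at `none`;
  -- two distinct elements suffice to activate exactly one.
  let t : (Σ i, Fin (m i)) ⊕ Option ι → L.Srt := Sum.elim (fun p => z p.1 p.2) fun _ => s₀
  have hdef : Definable (Sum.elim x t) fun (M : Structure.{u, w} L) c =>
      ∃ i, (c (.inr (.inr none)) : M.carrier s₀) = c (.inr (.inr (some i))) ∧
        Formula.Realize M (ξ i) (M.pair (fun j => c (.inl j)) fun j => c (.inr (.inl ⟨i, j⟩))) := by
    refine Definable.exists_finite fun i => Definable.and ?_ ?_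
    · exact Definable.eq (s := s₀) (IsTerm.var (σ := Sum.elim x t) (.inr (.inr none)))
        (IsTerm.var (σ := Sum.elim x t) (.inr (.inr (some i))))
    · refine Definable.realize (ξ i) (fun M (c : M.Tuple (Sum.elim x t)) =>
        M.pair (fun j => c (.inl j)) fun j => c (.inr (.inl ⟨i, j⟩))) ?_
      rintro (j | j)
      · exact IsTerm.var (σ := Sum.elim x t) (.inl j)
      · exact IsTerm.var (σ := Sum.elim x t) (.inr (.inl ⟨i, j⟩))
  obtain ⟨k, z', ψ, hψ⟩ := hdef.exists_pformula
  refine ⟨k, z', ψ, fun M hM X Y i h => ?_⟩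
  obtain ⟨b, hb⟩ := separable_iff.1 h
  obtain ⟨y, y', hy⟩ := hM
  -- Inactive disjuncts receive arbitrary parameters.
  let d : ∀ i, M.Tuple (z i) := Function.update
    (fun i j => Classical.choice (M.nonempty (z i j))) i b
  have hd : d i = b := Function.update_self _ _ _
  let b' : M.Tuple t := fun
    | .inl p => d p.1 p.2
    | .inr none => y
    | .inr (some i') => if i' = i then y else y'
  obtain ⟨c, hc⟩ := hψ M b'
  refine separable_iff.2 ⟨c, fun a => ?_⟩
  have : Formula.Realize M ψ (M.pair a c) ↔ Formula.Realize M (ξ i) (M.pair a b) := by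
    refine (hc a).trans ⟨?_, fun h => ⟨i, (if_pos rfl).symm, ?_⟩⟩
    · rintro ⟨i', h₁, h₂⟩
      have hi : i' = i := by
        by_contra hi
        exact hy (h₁.trans (if_neg hi))
      subst hi
      rw [← hd]
      exact h₂
    · rw [← hd] at h
      exact h
  rw [this]
  exact hb a

theorem PFormula.exists_swap {n m : ℕ} {x : Fin n → L.Srt} {t : Fin m → L.Srt}
    (φ : L.PFormula x t) : ∃ φ' : L.PFormula t x, ∀ (M : Structure.{u, w} L) a b,
      Formula.Realize M φ' (M.pair b a) ↔ Formula.Realize M φ (M.pair a b) := by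
  obtain ⟨φ', h⟩ := Definable.realize (σ := Sum.elim t x) φ
    (fun M c => M.pair (fun i => c (.inr i)) fun i => c (.inl i)) (by
      rintro (i | i)
      · exact IsTerm.var (σ := Sum.elim t x) (.inr i)
      · exact IsTerm.var (σ := Sum.elim t x) (.inl i))
  exact ⟨φ', fun M a b => h M (M.pair b a)⟩

/-- In an NIP theory, if `X` and `Y` can be separated by `φ` on all sets of `K` points, for a
suitable `K`, then all of their finite subsets can be separated by a single formula `ψ`. -/
theorem Theory.IsNIP.exists_finitelySeparable {T : L.Theory} (hT : Theory.IsNIP.{u, w} T)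
    (s₀ : L.Srt) {n m : ℕ} {x : Fin n → L.Srt} {t : Fin m → L.Srt} (φ : L.PFormula x t) :
    ∃ (K k : ℕ) (z : Fin k → L.Srt) (ψ : L.PFormula x z), ∀ M : Structure.{u, w} L, M.Models T →
      Nontrivial (M.carrier s₀) → ∀ X Y : Set (M.Tuple x), SeparatesTuples M φ K X Y →
        FinitelySeparable M ψ X Y := by
  classical
  obtain ⟨φ', hφ'⟩ := φ.exists_swap
  obtain ⟨k₁, hk₁⟩ := hT x t φ
  obtain ⟨k₂, hk₂⟩ := hT t x φ'
  obtain ⟨K, N, hKN⟩ := VC.exists_uniform_distinguishing.{w, w} k₁ k₂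
  -- `D` is a set of truth patterns for `N` instances of `φ`, and the relation says that the pattern
  -- of `x` lies in `D`. There are finitely many `D`, so one formula `ψ` covers all of them.
  have hdef : ∀ D : Set (Set (Fin N)),
      Definable (Sum.elim x fun i : Fin N × Fin m => t i.2) fun (M : Structure.{u, w} L) c =>
        ∃ d : D, ∀ i, Formula.Realize M φ
          (M.pair (fun j => c (.inl j)) fun j => c (.inr (i, j))) ↔ i ∈ (d : Set (Fin N)) := by
    intro D
    refine Definable.exists_finite fun d => Definable.forall_finite fun i =>
      Definable.iff ?_ (Definable.const _)
    refine Definable.realize φ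
      (fun M (c : M.Tuple (Sum.elim x fun i : Fin N × Fin m => t i.2)) =>
        M.pair (fun j => c (.inl j)) fun j => c (.inr (i, j))) ?_
    rintro (j | j) <;> exact IsTerm.var _
  choose k z ξ hξ using fun D => (hdef D).exists_pformula
  obtain ⟨k', z', ψ, hψ⟩ := exists_combination.{u, w} s₀ k z ξ
  refine ⟨K, k', z', ψ, fun M hM hs₀ X Y hXY X₀ Y₀ hX₀ hY₀ hX hY => ?_⟩
  have : Nonempty (M.Tuple t) := ⟨fun i => Classical.choice (M.nonempty _)⟩
  obtain ⟨b, hb⟩ := hKN (M.Tuple x) (M.Tuple t) (fun a b => Formula.Realize M φ (M.pair a b))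
    (hk₁ M hM) (fun h => hk₂ M hM (by
      obtain ⟨b, a, h⟩ := h
      exact ⟨b, a, fun i J => (hφ' M _ _).trans (h i J)⟩)) X₀ Y₀ hX₀ hY₀ (hXY.mono hX hY)
  -- For `D` take the patterns realized in `X₀`. No point of `Y₀` has such a pattern, since some
  -- instance distinguishes it from each point of `X₀`.
  refine hψ M hs₀ X₀ Y₀ ((fun a => {i | Formula.Realize M φ (M.pair a (b i))}) '' X₀) ?_
  obtain ⟨c, hc⟩ := hξ ((fun a => {i | Formula.Realize M φ (M.pair a (b i))}) '' X₀) M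
    fun i => b i.1 i.2
  refine separable_iff.2 ⟨c, fun a => ?_⟩
  rw [hc]
  refine ⟨fun ha => ⟨⟨_, a, ha, rfl⟩, fun i => Iff.rfl⟩, ?_⟩
  rintro ha ⟨⟨_, p, hp, rfl⟩, h⟩
  obtain ⟨i, hi⟩ := hb p hp a ha
  exact hi (h i).symm

/-! ### Complete theories -/

theorem Definable.forall_sentence {β : Type} [Finite β] {s : β → L.Srt}
    {R : ∀ M : Structure.{u, w} L, M.Tuple s → Prop} (hR : Definable s R) :
    Definable (Empty.elim : Empty → L.Srt) fun M _ => ∀ a, R M a :=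
  Definable.forall_tuple (R := fun M _ a => R M a) (hR.comp
    (fun M (c : M.Tuple (Sum.elim (Empty.elim : Empty → L.Srt) s)) j => c (.inr j))
    fun j => IsTerm.var (σ := Sum.elim (Empty.elim : Empty → L.Srt) s) (.inr j))

theorem Theory.IsComplete.transfer {T : L.Theory} (hT : Theory.IsComplete.{u, w} T) {β : Type}
    [Finite β] {s : β → L.Srt} {R : ∀ M : Structure.{u, w} L, M.Tuple s → Prop}
    (hR : Definable s R) {M N : Structure.{u, w} L} (hM : M.Models T) (hN : N.Models T)
    (h : ∀ a, R M a) (a : N.Tuple s) : R N a := by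
  obtain ⟨ψ, hψ⟩ := hR.forall_sentence
  rcases hT.2 ψ with h' | h'
  · exact (hψ N _).1 (h' N hN) a
  · exact absurd ((hψ M _).2 h) (h' M hM)

theorem definable_subsingleton (s : L.Srt) :
    Definable (fun _ : Bool => s) fun (_ : Structure.{u, w} L) c => c true = c false :=
  Definable.eq (IsTerm.var (σ := fun _ : Bool => s) true)
    (IsTerm.var (σ := fun _ : Bool => s) false)

theorem ElementaryEmbedding.subsingleton {M N : Structure.{u, w} L} (j : ElementaryEmbedding M N)
    (s : L.Srt) [Subsingleton (M.carrier s)] : Subsingleton (N.carrier s) := by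
  have hN := (j.map_definable (definable_subsingleton s).forall_sentence M.emptyTuple).2 fun a => Subsingleton.elim _ _
  exact ⟨fun c d => hN fun i => cond i c d⟩

/-- The sorts of `N` are singletons too, so `b` is the image of the only tuple of `M` with these
sorts. -/
theorem ExternallySeparable.separable_of_subsingleton {M : Structure.{u, w} L}
    [∀ s, Subsingleton (M.carrier s)] {n m : ℕ} {x : Fin n → L.Srt} {t : Fin m → L.Srt}
    {φ : L.PFormula x t} {X Y : Set (M.Tuple x)} (h : ExternallySeparable M φ X Y) :
    Separable M φ X Y := by
  obtain ⟨N, j, b, hX, hY⟩ := h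
  have hN : ∀ s, Subsingleton (N.carrier s) := fun s => j.subsingleton s
  refine ⟨fun i => Classical.choice (M.nonempty _), ?_⟩
  have key : ∀ a : M.Tuple x, (fun i => j.toFun _ (a i)) ∈ PFormula.solSet N φ b ↔
      a ∈ PFormula.solSet M φ fun i => Classical.choice (M.nonempty _) := by
    intro a
    refine Iff.trans (iff_of_eq ?_) (j.map_definable ⟨φ, fun _ _ => Iff.rfl⟩ _)
    refine congrArg (Formula.Realize N φ) (funext fun i => ?_)
    rcases i with i | i
    · rfl
    · exact (hN _).elim _ _
  simp only [key] at hX hY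
  exact ⟨hX, hY⟩

/-! ### Separation of definable sets of an enriched language -/

namespace Enrichment

variable (E : L.Enrichment) {n l m : ℕ} {x : Fin n → L.Srt} {s : Fin l → E.lang.Srt}
  {t : Fin m → L.Srt} (χ₁ χ₂ : E.lang.PFormula (fun i => Sum.inl (x i)) s) (φ : L.PFormula x t)

/-- This is the first-order replacement for external separability, which lets Łoś's theorem and
completeness be applied to it. -/
theorem definable_separatesTuples (K : ℕ) : Definable s fun (M : Structure.{u, w} E.lang) a =>
    SeparatesTuples (E.reduct M) φ K (E.solSet M χ₁ a) (E.solSet M χ₂ a) := by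
  let τ : Fin K × Fin n → E.lang.Srt := fun i => .inl (x i.2)
  let ρ : Fin m → E.lang.Srt := fun i => .inl (t i)
  have hχ : ∀ (χ : E.lang.PFormula (fun i => Sum.inl (x i)) s) (i : Fin K),
      Definable (Sum.elim (Sum.elim s τ) ρ) fun (M : Structure.{u, w} E.lang) c =>
        Formula.Realize M χ (M.pair (fun j => c (.inl (.inr (i, j)))) fun j => c (.inl (.inl j))) := by
    intro χ i
    refine Definable.realize χ (fun M (c : M.Tuple (Sum.elim (Sum.elim s τ) ρ)) =>
      M.pair (fun j => c (.inl (.inr (i, j)))) fun j => c (.inl (.inl j))) ?_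
    rintro (j | j)
    · exact IsTerm.var (σ := Sum.elim (Sum.elim s τ) ρ) (.inl (.inr (i, j)))
    · exact IsTerm.var (σ := Sum.elim (Sum.elim s τ) ρ) (.inl (.inl j))
  have hφ : ∀ i : Fin K,
      Definable (Sum.elim (Sum.elim s τ) ρ) fun (M : Structure.{u, w} E.lang) c =>
        Formula.Realize (E.reduct M) φ
          ((E.reduct M).pair (fun j => c (.inl (.inr (i, j)))) fun j => c (.inr j)) := by
    intro i
    refine E.definable_reduct (R := fun M a => Formula.Realize M φ a) ⟨φ, fun _ _ => Iff.rfl⟩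
      (fun M (c : M.Tuple (Sum.elim (Sum.elim s τ) ρ)) =>
        (E.reduct M).pair (fun j => c (.inl (.inr (i, j)))) fun j => c (.inr j)) ?_
    rintro (j | j)
    · exact IsTerm.var (σ := Sum.elim (Sum.elim s τ) ρ) (.inl (.inr (i, j)))
    · exact IsTerm.var (σ := Sum.elim (Sum.elim s τ) ρ) (.inr j)
  have h := Definable.forall_tuple (R := fun (M : Structure.{u, w} E.lang) (a : M.Tuple s)
      (p : M.Tuple τ) => ∃ b : M.Tuple ρ, ∀ i,
        (Formula.Realize M χ₁ (M.pair (fun j => p (i, j)) a) → Formula.Realize (E.reduct M) φ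
          ((E.reduct M).pair (fun j => p (i, j)) b)) ∧
        (Formula.Realize M χ₂ (M.pair (fun j => p (i, j)) a) → ¬ Formula.Realize (E.reduct M) φ
          ((E.reduct M).pair (fun j => p (i, j)) b)))
    (Definable.exists_tuple (Definable.forall_finite fun i =>
      ((hχ χ₁ i).imp (hφ i)).and ((hχ χ₂ i).imp (hφ i).not)))
  exact h.congr fun M a => ⟨fun h p => h fun i => p i.1 i.2, fun h p => h fun i j => p (i, j)⟩

theorem definable_separable : Definable s fun (M : Structure.{u, w} E.lang) a =>
    Separable (E.reduct M) φ (E.solSet M χ₁ a) (E.solSet M χ₂ a) := by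
  let τ : Fin n → E.lang.Srt := fun i => .inl (x i)
  let ρ : Fin m → E.lang.Srt := fun i => .inl (t i)
  have hχ : ∀ χ : E.lang.PFormula (fun i => Sum.inl (x i)) s,
      Definable (Sum.elim (Sum.elim s ρ) τ) fun (M : Structure.{u, w} E.lang) c =>
        Formula.Realize M χ (M.pair (fun j => c (.inr j)) fun j => c (.inl (.inl j))) := by
    intro χ
    refine Definable.realize χ (fun M (c : M.Tuple (Sum.elim (Sum.elim s ρ) τ)) =>
      M.pair (fun j => c (.inr j)) fun j => c (.inl (.inl j))) ?_
    rintro (j | j)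
    · exact IsTerm.var (σ := Sum.elim (Sum.elim s ρ) τ) (.inr j)
    · exact IsTerm.var (σ := Sum.elim (Sum.elim s ρ) τ) (.inl (.inl j))
  have hφ : Definable (Sum.elim (Sum.elim s ρ) τ) fun (M : Structure.{u, w} E.lang) c =>
      Formula.Realize (E.reduct M) φ
        ((E.reduct M).pair (fun j => c (.inr j)) fun j => c (.inl (.inr j))) := by
    refine E.definable_reduct (R := fun M a => Formula.Realize M φ a) ⟨φ, fun _ _ => Iff.rfl⟩
      (fun M (c : M.Tuple (Sum.elim (Sum.elim s ρ) τ)) =>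
        (E.reduct M).pair (fun j => c (.inr j)) fun j => c (.inl (.inr j))) ?_
    rintro (j | j)
    · exact IsTerm.var (σ := Sum.elim (Sum.elim s ρ) τ) (.inr j)
    · exact IsTerm.var (σ := Sum.elim (Sum.elim s ρ) τ) (.inl (.inr j))
  have h := Definable.exists_tuple (R := fun (M : Structure.{u, w} E.lang) (a : M.Tuple s)
      (b : M.Tuple ρ) => ∀ p : M.Tuple τ,
        (Formula.Realize M χ₁ (M.pair p a) →
          Formula.Realize (E.reduct M) φ ((E.reduct M).pair p b)) ∧
        (Formula.Realize M χ₂ (M.pair p a) →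
          ¬ Formula.Realize (E.reduct M) φ ((E.reduct M).pair p b)))
    (Definable.forall_tuple (R := fun (M : Structure.{u, w} E.lang) (c : M.Tuple (Sum.elim s ρ))
      (p : M.Tuple τ) =>
        (Formula.Realize M χ₁ (M.pair p fun j => c (.inl j)) →
          Formula.Realize (E.reduct M) φ ((E.reduct M).pair p fun j => c (.inr j))) ∧
        (Formula.Realize M χ₂ (M.pair p fun j => c (.inl j)) →
          ¬ Formula.Realize (E.reduct M) φ ((E.reduct M).pair p fun j => c (.inr j))))
      (((hχ χ₁).imp hφ).and ((hχ χ₂).imp hφ.not)))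
  exact h.congr fun M a =>
    (separable_iff (X := E.solSet M χ₁ a) (Y := E.solSet M χ₂ a)).symm

variable {χ₁ χ₂}

/-- By compactness, separating formulas can be chosen uniformly. -/
theorem exists_uniform_of_pointwise {T' : E.lang.Theory} (s₀ : L.Srt)
    (hs₀ : ∀ M : Structure.{u, max u w} E.lang, M.Models T' → Nontrivial (M.carrier (.inl s₀)))
    (h : ∀ M : Structure.{u, max u w} E.lang, M.Models T' → ∀ a : M.Tuple s,
      ∃ (k : ℕ) (z : Fin k → L.Srt) (ξ : L.PFormula x z),
        ExternallySeparable (E.reduct M) φ (E.solSet M χ₁ a) (E.solSet M χ₂ a) →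
          Separable (E.reduct M) ξ (E.solSet M χ₁ a) (E.solSet M χ₂ a)) :
    ∃ (k : ℕ) (z : Fin k → L.Srt) (ξ : L.PFormula x z),
      ∀ M : Structure.{u, max u w} E.lang, M.Models T' → ∀ a : M.Tuple s,
        ExternallySeparable (E.reduct M) φ (E.solSet M χ₁ a) (E.solSet M χ₂ a) →
          Separable (E.reduct M) ξ (E.solSet M χ₁ a) (E.solSet M χ₂ a) := by
  by_contra! hn
  let Ξ : Type u := Σ (k : ℕ) (z : Fin k → L.Srt), L.PFormula x z
  -- A counterexample to the combination of all formulas in `F` is a counterexample to each of them.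
  have hF : ∀ F : Finset Ξ, ∃ M : Structure.{u, max u w} E.lang, M.Models T' ∧ ∃ a : M.Tuple s,
      ExternallySeparable (E.reduct M) φ (E.solSet M χ₁ a) (E.solSet M χ₂ a) ∧
        ∀ ξ ∈ F, ¬ Separable (E.reduct M) ξ.2.2 (E.solSet M χ₁ a) (E.solSet M χ₂ a) := by
    intro F
    obtain ⟨k, z, ψ, hψ⟩ := exists_combination.{u, max u w} s₀
      (fun i : Fin F.card => (F.equivFin.symm i).1.1) (fun i => (F.equivFin.symm i).1.2.1)
      fun i => (F.equivFin.symm i).1.2.2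
    obtain ⟨M, hM, a, h₁, h₂⟩ := hn k z ψ
    refine ⟨M, hM, a, h₁, fun ξ hξ hsep => h₂ (hψ (E.reduct M) (hs₀ M hM) _ _
      (F.equivFin ⟨ξ, hξ⟩) ?_)⟩
    rw [F.equivFin.symm_apply_apply]
    exact hsep
  choose M hM a hext hsep using hF
  let U : Ultrafilter (Finset Ξ) := Ultrafilter.of Filter.atTop
  let a' : (ultraproduct.{u, u, max u w} U M).Tuple s := fun k => ultraMk U M fun F => a F k
  obtain ⟨k, z, ξ, hξ⟩ := h (ultraproduct.{u, u, max u w} U M) (ultraproduct_models U M hM) a'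
  -- External separability itself passes to the ultraproduct, because it amounts to the definable
  -- conditions for all `K`.
  have h₁ := hξ <| FinitelySeparable.externallySeparable <|
    finitelySeparable_of_separatesTuples fun K =>
      ((E.definable_separatesTuples χ₁ χ₂ φ K).ultraproduct_iff U M fun k F => a F k).2 <|
        .of_forall fun F => (hext F).separatesTuples K
  have h₂ := ((E.definable_separable χ₁ χ₂ ξ).ultraproduct_iff U M fun k F => a F k).1 h₁
  -- The ultrafilter contains the cone above each finite set, so almost every `F` was chosen to
  -- defeat this very `ξ`.
  have h₃ : ∀ᶠ F in (U : Filter (Finset Ξ)), (⟨k, z, ξ⟩ : Ξ) ∈ F :=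
    Ultrafilter.of_le _ ((Filter.eventually_ge_atTop {⟨k, z, ξ⟩}).mono fun F hF => hF (by simp))
  obtain ⟨F, h₄, h₅⟩ := (h₂.and h₃).exists
  exact hsep F _ h₅ h₄

/-- In an NIP theory, a formula that separates in a single model separates in all models. -/
theorem exists_uniform_of_model {T : L.Theory} (hT : Theory.IsNIP.{u, w} T) {T' : E.lang.Theory}
    (hTT' : ∀ ψ ∈ T, E.liftSentence ψ ∈ T') (hT' : Theory.IsComplete.{u, w} T') (s₀ : L.Srt)
    (hs₀ : ∀ M : Structure.{u, w} E.lang, M.Models T' → Nontrivial (M.carrier (.inl s₀)))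
    (h : ∀ {m : ℕ} (t : Fin m → L.Srt) (φ : L.PFormula x t),
      ∃ (k : ℕ) (z : Fin k → L.Srt) (ξ : L.PFormula x z) (M : Structure.{u, w} E.lang),
        M.Models T' ∧ ∀ a : M.Tuple s,
          ExternallySeparable (E.reduct M) φ (E.solSet M χ₁ a) (E.solSet M χ₂ a) →
            Separable (E.reduct M) ξ (E.solSet M χ₁ a) (E.solSet M χ₂ a)) :
    ∃ (k : ℕ) (z : Fin k → L.Srt) (ξ : L.PFormula x z),
      ∀ M : Structure.{u, w} E.lang, M.Models T' → ∀ a : M.Tuple s,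
        ExternallySeparable (E.reduct M) φ (E.solSet M χ₁ a) (E.solSet M χ₂ a) →
          Separable (E.reduct M) ξ (E.solSet M χ₁ a) (E.solSet M χ₂ a) := by
  obtain ⟨K, k, z, ψ, hψ⟩ := hT.exists_finitelySeparable s₀ φ
  obtain ⟨k', z', ξ, M, hM, hξ⟩ := h z ψ
  refine ⟨k', z', ξ, fun N hN a hext => ?_⟩
  -- The transferred statement has the definable premise for `φ` and `K`. In `M` this premise yields
  -- external `ψ`-separability, to which the choice of `ξ` applies.
  refine hT'.transfer ((E.definable_separatesTuples χ₁ χ₂ φ K).imp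
    (E.definable_separable χ₁ χ₂ ξ)) hM hN (fun a h => hξ a ?_) a (hext.separatesTuples K)
  exact (hψ _ (E.reduct_models hTT' hM) (hs₀ M hM) _ _ h).externallySeparable

end Enrichment

end MSLanguage

/-! ### The equivalence of the three conditions -/

theorem mainTheorem4 (L : MSLanguage.{u}) (T : L.Theory)
    (hT : MSLanguage.Theory.IsNIP.{u, max u w} T)
    (E : L.Enrichment) (T' : E.lang.Theory) (hTT' : ∀ ψ ∈ T, E.liftSentence ψ ∈ T')
    (hT' : MSLanguage.Theory.IsComplete.{u, max u w} T')
    {n l : ℕ} (x : Fin n → L.Srt) (s : Fin l → E.lang.Srt)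
    (χ₁ χ₂ : E.lang.PFormula (fun i => Sum.inl (x i)) s) :
    List.TFAE [
      -- pointwise
      ∀ {m : ℕ} (t : Fin m → L.Srt) (φ : L.PFormula x t)
        (M : MSLanguage.Structure.{u, max u w} E.lang), M.Models T' → ∀ a : M.Tuple s,
        ∃ (k : ℕ) (z : Fin k → L.Srt) (ξ : L.PFormula x z),
          MSLanguage.ExternallySeparable (E.reduct M) φ (E.solSet M χ₁ a) (E.solSet M χ₂ a) →
            MSLanguage.Separable (E.reduct M) ξ (E.solSet M χ₁ a) (E.solSet M χ₂ a),
      -- uniformly over all models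
      ∀ {m : ℕ} (t : Fin m → L.Srt) (φ : L.PFormula x t),
        ∃ (k : ℕ) (z : Fin k → L.Srt) (ξ : L.PFormula x z),
          ∀ M : MSLanguage.Structure.{u, max u w} E.lang, M.Models T' → ∀ a : M.Tuple s,
            MSLanguage.ExternallySeparable (E.reduct M) φ (E.solSet M χ₁ a) (E.solSet M χ₂ a) →
              MSLanguage.Separable (E.reduct M) ξ (E.solSet M χ₁ a) (E.solSet M χ₂ a),
      -- in a single model
      ∀ {m : ℕ} (t : Fin m → L.Srt) (φ : L.PFormula x t),
        ∃ (k : ℕ) (z : Fin k → L.Srt) (ξ : L.PFormula x z)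
          (M : MSLanguage.Structure.{u, max u w} E.lang), M.Models T' ∧ ∀ a : M.Tuple s,
            MSLanguage.ExternallySeparable (E.reduct M) φ (E.solSet M χ₁ a) (E.solSet M χ₂ a) →
              MSLanguage.Separable (E.reduct M) ξ (E.solSet M χ₁ a) (E.solSet M χ₂ a)] := by
  obtain ⟨M₀, hM₀⟩ := hT'.1
  tfae_have 2 → 1 := by
    intro h m t φ M hM a
    obtain ⟨k, z, ξ, hξ⟩ := h t φ
    exact ⟨k, z, ξ, hξ M hM a⟩
  tfae_have 2 → 3 := by
    intro h m t φ
    obtain ⟨k, z, ξ, hξ⟩ := h t φ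
    exact ⟨k, z, ξ, M₀, hM₀, hξ M₀ hM₀⟩
  by_cases hs : ∃ s₀ : L.Srt, ∀ M : MSLanguage.Structure.{u, max u w} E.lang, M.Models T' →
      Nontrivial (M.carrier (.inl s₀))
  · obtain ⟨s₀, hs₀⟩ := hs
    tfae_have 1 → 2 := fun h m t φ => E.exists_uniform_of_pointwise φ s₀ hs₀ (h t φ)
    tfae_have 3 → 2 := fun h m t φ => E.exists_uniform_of_model φ hT hTT' hT' s₀ hs₀ h
    tfae_finish
  · have h₂ : ∀ {m : ℕ} (t : Fin m → L.Srt) (φ : L.PFormula x t),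
        ∃ (k : ℕ) (z : Fin k → L.Srt) (ξ : L.PFormula x z),
          ∀ M : MSLanguage.Structure.{u, max u w} E.lang, M.Models T' → ∀ a : M.Tuple s,
            MSLanguage.ExternallySeparable (E.reduct M) φ (E.solSet M χ₁ a) (E.solSet M χ₂ a) →
              MSLanguage.Separable (E.reduct M) ξ (E.solSet M χ₁ a) (E.solSet M χ₂ a) := by
      intro m t φ
      refine ⟨m, t, φ, fun M hM a hext => ?_⟩
      -- For each sort `r` some model has at most one element of this sort; by completeness, so do
      -- all models.
      have : ∀ r, Subsingleton ((E.reduct M).carrier r) := by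
        intro r
        by_contra hr
        refine hs ⟨r, fun N hN => ?_⟩
        by_contra hN'
        rw [not_nontrivial_iff_subsingleton] at hN'
        refine hr ⟨fun c d => ?_⟩
        exact hT'.transfer (MSLanguage.definable_subsingleton (L := E.lang) (.inl r)) hN hM
          (fun a => hN'.elim _ _) fun i => cond i c d
      exact hext.separable_of_subsingleton
    tfae_have 1 → 2 := fun _ => h₂
    tfae_have 3 → 2 := fun _ => h₂
    tfae_finish
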